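/- Setting. Let $m,p,T\ge 1$ and let $X_t=(X_t^1,\dots,X_t^m)$, $X_t^i\in\mathbb R^p$, be a strictly stationary solution of $X_t^i=\sum_{j=1}^m B^\star_{ij}X_{t-1}^j+\epsilon_t^i$, $B^\star_{ij}=\gamma^\star_{ij}\Theta^\star_{ij}$, where $\epsilon_t=(\epsilon_t^1,\dots,\epsilon_t^m)$ is centred jointly Gaussian, independent of $(X_u)_{u<t}$, and $\mathrm{Cov}(\epsilon^j_t)=\sigma^2 I_p$ with $\sigma>0$. Assume: the support of every $\Theta^\star_{ij}$ lies in a given set $\mathcal J_0$ of location pairs; $\|\Theta^\star_{ij}\|_F=1$ if $\gamma^\star_{ij}\ne 0$ and $\Theta^\star_{ij}=0$ if $\gamma^\star_{ij}=0$; $\|\Gamma^\star\|_0\le s_\Gamma$, and every block $\Theta^\star_{ij}$ has at most $s_\Theta$ nonzero entries (in particular $s_\Theta=\sum_{i,j}\|\Theta^\star_{ij}\|_0$ is allowed); $|\gamma^\star_{ij}|\le C_\Gamma$ for all $i,j$, and $|\gamma^\star_{ij}|\ge g>0$ whenever $\gamma_{ij}^\star\neq0$; the weights satisfy $1\le w_{ss'}\le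 r_w$ on $\mathcal J_0$, where $r_w\ge 1$; the eigenvalues of the spectral density of $(X_t)$ lie in $[\mathfrak m,\mathcal M]$ for all frequencies, where $\mathfrak m>0$; and $\det(I-zB^\star)\ne0$ for $|z|=1$. For an $m\times m$ matrix $\widehat\Gamma$ let $\mathbf X_{\widehat\Gamma}$ be the block diagonal $mT\times m^2p$ matrix with $i$-th block $[\widehat\gamma_{i1}\mathcal X_1,\dots,\widehat\gamma_{im}\mathcal X_m]$, $\mathcal X_j=[X_0^j,\dots,X_{T-1}^j]'$; let $\mathbf y$ stack the matrices $[X_1^i,\dots,X_T^i]'$, $i=1,\dots,m$; let $\widehat{\mathfrak X}_\Gamma=I_p\otimes(\mathbf X_{\widehat\Gamma}'\mathbf X_{\widehat\Gamma}/T)$ and $\widehat\gamma_\Gamma=(I_p\otimes\mathbf X_{\widehat\Gamma}')\mathrm{vec}(\mathbf y)/T$; and let $\beta_\Theta$ be the vectorization of the stacked blocks $\Theta_{ij}'$. The update $\widehat\beta_\Theta$ is any minimizer of $$-2\beta'\widehat\gamma_\Gamma+\beta'\widehat{\mathfrak X}_\Gamma\beta+\mu_T\sum_{i,j,s,s'}w_{ss'}|\Theta_{ij}(s,s')|$$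 over all $\beta=\beta_\Theta$ whose blocks $\Theta_{ij}$ are supported in $\mathcal J_0$. For a set $A$ of coordinates, say that $\mathrm{RE}_A(\alpha,\phi)$ holds if $v'\widehat{\mathfrak X}_\Gamma v\ge\alpha\|v_A\|_2^2-\phi\|v\|_1^2$ for all $v\in\mathbb R^{m^2p^2}$ (the usual restricted eigenvalue condition is the case where $A$ consists of all coordinates), and say that the deviation bound holds with $q$ if $\|\widehat\gamma_\Gamma-\widehat{\mathfrak X}_\Gamma\beta^\star_\Theta\|_\infty\le q\sqrt{(\log m+\log p)/T}$. Let $A^\star$ be the set of coordinates of the blocks $(i,j)$ with $\gamma^\star_{ij}\ne0$. Theorem 3 (error bound for $\widehat\beta_\Theta$ with $\mathbf X_\Gamma$ and $\mathbf E$). (i) For every realization of $(X_t)$ and every $\widehat\Gamma$, if $\mathrm{RE}_A(\alpha_\Theta,\phi_\Theta)$ holds for some $A\supseteq A^\star$, $\alpha_\Theta>0$ and $\phi_\Theta$ with $8(1+r_w)^2s_\Gamma s_\Theta\phi_\Theta\le\alpha_\Theta$, if the deviation bound holds with $q$, and if $\mu_T>0$ and $\mu_T\ge4q\sqrt{(\log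 m+\log p)/T}$, then every update satisfies $$\|\widehat\beta_\Theta-\beta_\Theta^\star\|_1\le\frac{2+6r_ws_\Gamma+4r_w^2s_\Gamma^2}{\alpha_\Theta}\,s_\Theta\,\mu_T.\qquad(*)$$ (ii) There are universal constants $c_1',c_2',c_3',c_4'>0$ such that for every $\eta_\Gamma>0$ there are constants $\alpha_\Theta,\phi_0,C>0$ with $8(1+r_w)^2s_\Gamma s_\Theta\phi_0/C\le\alpha_\Theta$ and a nondecreasing function $\mathbb Q$, all depending only on $(r_w,\eta_\Gamma,g,C_\Gamma,\mathfrak m,\mathcal M,s_\Gamma,s_\Theta)$ and not on $m,p,T$ or anything else, for which the following holds. If $T\ge C(\log m+\log p)$ then, with $\nu_\Gamma=\eta_\Gamma\sqrt{\log m/T}$, there is an event of probability at least $$1-c_1'e^{-c_2'(\log m+\log p)}-c_3'T^{-c_4'}$$ on which, for every $\widehat\Gamma$ with $\|\widehat\beta_\Gamma-\beta_\Gamma^\star\|_\infty=\max_{i,j}|\widehat\gamma_{ij}-\gamma_{ij}^\star|\le\nu_\Gamma$: $\mathrm{RE}_{A^\star}(\alpha_\Theta,\phi_0(\log m+\log p)/T)$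 holds, the deviation bound holds with $q=\mathbb Q(\nu_\Gamma)$, and, for every $\mu_T>0$ with $\mu_T\ge4\mathbb Q(\nu_\Gamma)\sqrt{(\log m+\log p)/T}$, the update exists and every update satisfies $(*)$. -/

import Mathlib

open MeasureTheory ProbabilityTheory
open scoped Matrix Kronecker ComplexOrder

noncomputable section

namespace SpatialVAR

/-- The block transition matrix `B⋆` with blocks `B_ij = γ_ij Θ_ij`; a coordinate `(i, s)` is
variable `i` at location `s`. -/
def transition {m p : ℕ} (G : Matrix (Fin m) (Fin m) ℝ)
    (Th : Fin m → Fin m → Matrix (Fin p) (Fin p) ℝ) :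
    Matrix (Fin m × Fin p) (Fin m × Fin p) ℝ :=
  Matrix.of fun a b => G a.1 b.1 * Th a.1 b.1 a.2 b.2

/-- Structural assumptions on the true parameters: the spatial support lies in `J0`, active blocks
have Frobenius norm one and inactive blocks vanish, `‖Γ⋆‖₀ ≤ sG`, every block has at most `sT`
nonzero entries, and the active entries of `Γ⋆` lie in absolute value between `g` and `CG`. -/
structure TrueParams {m p : ℕ} (J0 : Set (Fin p × Fin p)) (sG sT : ℕ) (g CG : ℝ)
    (G : Matrix (Fin m) (Fin m) ℝ) (Th : Fin m → Fin m → Matrix (Fin p) (Fin p) ℝ) : Prop where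
  support : ∀ i j s s', Th i j s s' ≠ 0 → (s, s') ∈ J0
  normalized : ∀ i j, G i j ≠ 0 → ∑ s, ∑ s', Th i j s s' ^ 2 = 1
  inactive : ∀ i j, G i j = 0 → Th i j = 0
  sparse_G : {e : Fin m × Fin m | G e.1 e.2 ≠ 0}.ncard ≤ sG
  sparse_Th : ∀ i j, {e : Fin p × Fin p | Th i j e.1 e.2 ≠ 0}.ncard ≤ sT
  lower_G : ∀ i j, G i j ≠ 0 → g ≤ |G i j|
  upper_G : ∀ i j, |G i j| ≤ CG

/-- Spatial weights between `1` and `r` on the admissible spatial graph. -/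
def AdmissibleWeights {p : ℕ} (J0 : Set (Fin p × Fin p)) (r : ℝ)
    (w : Matrix (Fin p) (Fin p) ℝ) : Prop :=
  ∀ s s', (s, s') ∈ J0 → 1 ≤ w s s' ∧ w s s' ≤ r

/-- `X` is a strictly stationary solution of the system `X_t = B X_{t-1} + ε_t` on `ℤ`, where the
jointly Gaussian noise `ε_t` is centred and independent of the past of `X`, and the noise of each
variable has covariance `σ² I_p`. -/
structure IsStationaryVAR {m p : ℕ} {Ω : Type*} [MeasurableSpace Ω] (P : Measure Ω)
    (B : Matrix (Fin m × Fin p) (Fin m × Fin p) ℝ) (σ : ℝ)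
    (X ε : ℤ → Ω → (Fin m × Fin p → ℝ)) : Prop where
  measurable_X : ∀ t, Measurable (X t)
  measurable_noise : ∀ t, Measurable (ε t)
  recursion : ∀ t ω, X t ω = B *ᵥ X (t - 1) ω + ε t ω
  stationary : ∀ h : ℤ, P.map (fun ω t => X (t + h) ω) = P.map (fun ω t => X t ω)
  gaussian : ∀ t, IsGaussian (P.map (ε t))
  centred : ∀ t a, ∫ ω, ε t ω a ∂P = 0
  covariance : ∀ t i s s',
    covariance (fun ω => ε t ω (i, s)) (fun ω => ε t ω (i, s')) P = if s = s' then σ ^ 2 else 0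
  indep_past : ∀ t, IndepFun (ε t) (fun ω (u : Set.Iio t) => X u ω) P

/-- Autocovariance `Cov(X_0, X_l)`, which is `Cov(X_t, X_{t+l})` for a stationary process. -/
def autocov {m p : ℕ} {Ω : Type*} [MeasurableSpace Ω] (P : Measure Ω)
    (X : ℤ → Ω → (Fin m × Fin p → ℝ)) (l : ℤ) : Matrix (Fin m × Fin p) (Fin m × Fin p) ℝ :=
  Matrix.of fun a b => covariance (fun ω => X 0 ω a) (fun ω => X l ω b) P

/-- Spectral density `(2π)⁻¹ ∑_l Cov(X_0, X_l) e^{-ilθ}`. -/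
def spectralDensity {m p : ℕ} {Ω : Type*} [MeasurableSpace Ω] (P : Measure Ω)
    (X : ℤ → Ω → (Fin m × Fin p → ℝ)) (θ : ℝ) : Matrix (Fin m × Fin p) (Fin m × Fin p) ℂ :=
  (1 / (2 * (Real.pi : ℂ))) •
    ∑' l : ℤ, Complex.exp (-(Complex.I * (l : ℂ) * (θ : ℂ))) •
      (autocov P X l).map (fun x : ℝ => (x : ℂ))

/-- Stability: all eigenvalues of the (Hermitian) spectral density lie in `[lo, hi]` for every
frequency, and the characteristic polynomial has no zero on the unit circle. -/
structure Stable {m p : ℕ} {Ω : Type*} [MeasurableSpace Ω] (P : Measure Ω)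
    (B : Matrix (Fin m × Fin p) (Fin m × Fin p) ℝ)
    (X : ℤ → Ω → (Fin m × Fin p → ℝ)) (lo hi : ℝ) : Prop where
  lower : ∀ θ ∈ Set.Icc (-Real.pi) Real.pi,
    (spectralDensity P X θ - (lo : ℂ) • (1 : Matrix _ _ ℂ)).PosSemidef
  upper : ∀ θ ∈ Set.Icc (-Real.pi) Real.pi,
    ((hi : ℂ) • (1 : Matrix _ _ ℂ) - spectralDensity P X θ).PosSemidef
  det_ne : ∀ z : ℂ, ‖z‖ = 1 →
    ((1 : Matrix (Fin m × Fin p) (Fin m × Fin p) ℂ) - z • B.map (fun x : ℝ => (x : ℂ))).det ≠ 0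

/-- The response matrix `y` (blocks `[X_1^i, …, X_T^i]'`, stacked over `i`) of a trajectory. -/
def response {m p : ℕ} (T : ℕ) (x : ℤ → (Fin m × Fin p → ℝ)) :
    Matrix (Fin m × Fin T) (Fin p) ℝ :=
  Matrix.of fun a s => x ((a.2 : ℕ) + 1) (a.1, s)

/-- The block diagonal design `X_Γ` whose `i`-th block is `[γ_i1 𝒳_1, …, γ_im 𝒳_m]`, where
`𝒳_j = [X_0^j, …, X_{T-1}^j]'`. -/
def design {m p : ℕ} (T : ℕ) (x : ℤ → (Fin m × Fin p → ℝ)) (G : Matrix (Fin m) (Fin m) ℝ) :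
    Matrix (Fin m × Fin T) (Fin m × Fin m × Fin p) ℝ :=
  Matrix.of fun a b => if a.1 = b.1 then G b.1 b.2.1 * x (a.2 : ℕ) (b.2.1, b.2.2) else 0

/-- Index set of the vectorized spatial parameter: `(s, (i, j, s'))` is the entry
`Θ_ij(s, s')`. -/
abbrev Idx (m p : ℕ) : Type := Fin p × (Fin m × Fin m × Fin p)

/-- `β_Θ`: the vectorization of the stacked matrix with blocks `Θ_ij'`. -/
def betaTheta {m p : ℕ} (Th : Fin m → Fin m → Matrix (Fin p) (Fin p) ℝ) : Idx m p → ℝ :=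
  Matrix.vec (Matrix.of fun (b : Fin m × Fin m × Fin p) (s : Fin p) => Th b.1 b.2.1 s b.2.2)

/-- `γ̂_Γ = (I_p ⊗ X_Γ') vec(y) / T`. -/
def crossMoment {m p : ℕ} (T : ℕ) (x : ℤ → (Fin m × Fin p → ℝ)) (G : Matrix (Fin m) (Fin m) ℝ) :
    Idx m p → ℝ :=
  (T : ℝ)⁻¹ • (((1 : Matrix (Fin p) (Fin p) ℝ) ⊗ₖ (design T x G)ᵀ) *ᵥ Matrix.vec (response T x))

/-- The empirical Gram matrix `I_p ⊗ (X_Γ' X_Γ / T)`. -/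
def gram {m p : ℕ} (T : ℕ) (x : ℤ → (Fin m × Fin p → ℝ)) (G : Matrix (Fin m) (Fin m) ℝ) :
    Matrix (Idx m p) (Idx m p) ℝ :=
  (1 : Matrix (Fin p) (Fin p) ℝ) ⊗ₖ ((T : ℝ)⁻¹ • ((design T x G)ᵀ * design T x G))

/-- Vectors whose spatial pattern lies in `J0`. -/
def feasible {m p : ℕ} (J0 : Set (Fin p × Fin p)) : Set (Idx m p → ℝ) :=
  {β | ∀ k, β k ≠ 0 → (k.1, k.2.2.2) ∈ J0}

/-- The objective `-2 β'γ̂_Γ + β'𝔛̂_Γ β + μ ‖D_W β‖₁`. -/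
def thetaObjective {m p : ℕ} (T : ℕ) (x : ℤ → (Fin m × Fin p → ℝ)) (G : Matrix (Fin m) (Fin m) ℝ)
    (w : Matrix (Fin p) (Fin p) ℝ) (μ : ℝ) (β : Idx m p → ℝ) : ℝ :=
  -2 * (β ⬝ᵥ crossMoment T x G) + β ⬝ᵥ (gram T x G *ᵥ β) + μ * ∑ k, |w k.1 k.2.2.2 * β k|

/-- `β` is a spatially weighted, support-constrained Lasso update of `Θ`, given `Γ = G`. -/
def IsThetaUpdate {m p : ℕ} (T : ℕ) (x : ℤ → (Fin m × Fin p → ℝ)) (G : Matrix (Fin m) (Fin m) ℝ)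
    (J0 : Set (Fin p × Fin p)) (w : Matrix (Fin p) (Fin p) ℝ) (μ : ℝ) (β : Idx m p → ℝ) : Prop :=
  β ∈ feasible J0 ∧ IsMinOn (thetaObjective T x G w μ) (feasible J0) β

/-- Restricted eigenvalue condition with curvature on the coordinates in `A`:
`v'Mv ≥ α ‖v_A‖₂² - φ ‖v‖₁²` for all `v`. The usual condition is `A = univ`. -/
def RestrictedEigenvalue {κ : Type*} [Fintype κ] (M : Matrix κ κ ℝ) (A : Finset κ)
    (α φ : ℝ) : Prop :=
  ∀ v : κ → ℝ, α * ∑ k ∈ A, v k ^ 2 - φ * (∑ k, |v k|) ^ 2 ≤ v ⬝ᵥ (M *ᵥ v)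

open Classical in
/-- Coordinates belonging to active variable pairs, `γ_ij ≠ 0`. -/
def activeCoords {m p : ℕ} (G : Matrix (Fin m) (Fin m) ℝ) : Finset (Idx m p) :=
  Finset.univ.filter fun k => G k.2.1 k.2.2.1 ≠ 0

/-- Deviation bound `‖γ̂_Γ - 𝔛̂_Γ β‖_∞ ≤ q √((log p + log m) / T)`. -/
def DeviationBound {m p : ℕ} (T : ℕ) (x : ℤ → (Fin m × Fin p → ℝ)) (G : Matrix (Fin m) (Fin m) ℝ)
    (β : Idx m p → ℝ) (q : ℝ) : Prop :=
  ∀ k, |crossMoment T x G k - (gram T x G *ᵥ β) k| ≤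
    q * √((Real.log p + Real.log m) / T)

/-- `‖β - β'‖₁ ≤ (2 + 6 r sG + 4 r² sG²) / α * sT * μ`. -/
def ErrorBound {κ : Type*} [Fintype κ] (β β' : κ → ℝ) (r : ℝ) (sG sT : ℕ) (α μ : ℝ) : Prop :=
  ∑ k, |β k - β' k| ≤ (2 + 6 * r * sG + 4 * r ^ 2 * (sG : ℝ) ^ 2) / α * sT * μ

end SpatialVAR

end

noncomputable section

namespace SpatialVAR

/-! ### The weighted Lasso -/

section Lasso

variable {κ : Type*} [Fintype κ]

/-! The proof combines a deterministic Lasso argument with a single event that does not involve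
`Ghat`.

Deterministic part. Comparing the objective at a minimizer and at the truth gives a basic
inequality, which forces the error into a cone; curvature on the support of the truth then bounds
its ℓ¹ norm (`lasso_error`). Curvature is used nowhere else, which is why the restricted eigenvalue
condition may be confined to the active blocks: an inactive block can have weight zero in `Ghat`,
and then the Gram form vanishes on it.

Reduction to unweighted data. The Gram form is a sum of sample second moments of scalar combinations
of `X_t` (`gram_quadratic`). As `|Ghat i j|` is at least `g / 2` on active blocks and bounded
everywhere, curvature of the plain sample covariance is inherited (`restrictedEigenvalue_gram`). The
score at the truth is a noise correlation plus a term linear in `G - Ghat`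
(`abs_crossMoment_sub_le`). Everything random is now a statement about `X` and `ε` alone, so one
event serves all `Ghat` in the neighbourhood, including those computed from the data.

Probability. The strict lower spectral bound forces summable autocovariances, finite second moments,
an invertible `autocov P X 0` and `B ^ n → 0`. Iterating the recursion for the characteristic
function then shows that `X` is centred Gaussian, and Toeplitz forms bound the variances of its
linear combinations by the spectral bounds. Writing the exponential of a square as a Gaussian
average of exponentials of linear forms turns this into tail bounds for sums of squares. The noise
correlation is handled by an exponential supermartingale on the event of bounded sample variances.

Curvature is checked only on the `(2mp)^k` words in `k` signed basis vectors, where `k` is of order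
`T / (log m + log p)`. Maurey's empirical method (`quadratic_lower_of_signedSum`) extends it to all
vectors at the cost of a multiple `K / (k - 1)` of the squared ℓ¹ norm, which is the tolerance in
the restricted eigenvalue condition. -/

lemma quadratic_expand {M : Matrix κ κ ℝ} (hM : M.IsSymm) (β β₀ : κ → ℝ) :
    β ⬝ᵥ (M *ᵥ β) =
      β₀ ⬝ᵥ (M *ᵥ β₀) + 2 * ((β - β₀) ⬝ᵥ (M *ᵥ β₀)) + (β - β₀) ⬝ᵥ (M *ᵥ (β - β₀)) := by
  have h : β₀ ⬝ᵥ (M *ᵥ β) = β ⬝ᵥ (M *ᵥ β₀) := by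
    rw [Matrix.dotProduct_mulVec, ← Matrix.mulVec_transpose, hM.eq, dotProduct_comm]
  simp only [Matrix.mulVec_sub, sub_dotProduct, dotProduct_sub, h]
  ring

/-- Oracle inequality for the weighted Lasso in terms of an arbitrary support set `S` of the
target. -/
theorem lasso_error {M : Matrix κ κ ℝ} (hM : M.IsSymm) (hpsd : ∀ v, 0 ≤ v ⬝ᵥ (M *ᵥ v))
    {γ β β₀ w : κ → ℝ} {S : Finset κ} {s r a φ μ : ℝ} (hs : (S.card : ℝ) ≤ s)
    (hS : ∀ k ∉ S, β₀ k = 0) (ha : 0 < a) (hμ : 0 < μ)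
    (hφ : 8 * (1 + r) ^ 2 * s * φ ≤ a)
    (hw : ∀ k, β k - β₀ k ≠ 0 → 1 ≤ w k ∧ w k ≤ r)
    (hdev : ∀ k, |γ k - (M *ᵥ β₀) k| ≤ μ / 4)
    (hRE : a * ∑ k ∈ S, (β k - β₀ k) ^ 2 - φ * (∑ k, |β k - β₀ k|) ^ 2 ≤
      (β - β₀) ⬝ᵥ (M *ᵥ (β - β₀)))
    (hmin : -2 * (β ⬝ᵥ γ) + β ⬝ᵥ (M *ᵥ β) + μ * ∑ k, |w k * β k| ≤
      -2 * (β₀ ⬝ᵥ γ) + β₀ ⬝ᵥ (M *ᵥ β₀) + μ * ∑ k, |w k * β₀ k|) :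
    ∑ k, |β k - β₀ k| ≤ (1 + r) ^ 2 * s / a * μ := by
  classical
  set Δ : κ → ℝ := β - β₀ with hΔ
  have hΔk : ∀ k, β k - β₀ k = Δ k := fun k => rfl
  simp only [hΔk] at hw hRE ⊢
  rw [quadratic_expand hM β β₀] at hmin
  set Z := Δ ⬝ᵥ (M *ᵥ Δ) with hZ
  set x := ∑ k ∈ S, |Δ k| with hx
  set y := ∑ k ∈ Sᶜ, |Δ k| with hy
  have hxy : ∑ k, |Δ k| = x + y := (Finset.sum_add_sum_compl S _).symm
  have hx0 : 0 ≤ x := Finset.sum_nonneg fun _ _ => abs_nonneg _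
  have hy0 : 0 ≤ y := Finset.sum_nonneg fun _ _ => abs_nonneg _
  have hlin : Δ ⬝ᵥ (γ - M *ᵥ β₀) ≤ μ / 4 * (x + y) := by
    rw [← hxy, Finset.mul_sum]
    refine Finset.sum_le_sum fun k _ => ?_
    calc Δ k * (γ - M *ᵥ β₀) k ≤ |Δ k| * |(γ - M *ᵥ β₀) k| := by
          rw [← abs_mul]; exact le_abs_self _
      _ ≤ |Δ k| * (μ / 4) := mul_le_mul_of_nonneg_left (hdev k) (abs_nonneg _)
      _ = _ := mul_comm _ _
  have hlin' : β ⬝ᵥ γ - β₀ ⬝ᵥ γ - Δ ⬝ᵥ (M *ᵥ β₀) ≤ μ / 4 * (x + y) := by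
    have : Δ ⬝ᵥ (γ - M *ᵥ β₀) = β ⬝ᵥ γ - β₀ ⬝ᵥ γ - Δ ⬝ᵥ (M *ᵥ β₀) := by
      rw [dotProduct_sub, hΔ, sub_dotProduct]
    linarith
  have hpen : ∑ k, |w k * β₀ k| - ∑ k, |w k * β k| ≤ r * x - y := by
    rw [← Finset.sum_sub_distrib, ← Finset.sum_add_sum_compl S, hx, hy, Finset.mul_sum,
      sub_eq_add_neg, ← Finset.sum_neg_distrib]
    refine add_le_add (Finset.sum_le_sum fun k _ => ?_) (Finset.sum_le_sum fun k hk => ?_)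
    · have h1 : |w k * β₀ k| - |w k * β k| ≤ |w k * Δ k| := by
        have := abs_sub_abs_le_abs_sub (w k * β₀ k) (w k * β k)
        rwa [← mul_sub, ← neg_sub (β k), hΔk, mul_neg, abs_neg] at this
      refine h1.trans ?_
      by_cases h0 : Δ k = 0
      · simp [h0]
      · rw [abs_mul, abs_of_nonneg (by linarith [(hw k h0).1] : 0 ≤ w k)]
        exact mul_le_mul_of_nonneg_right (hw k h0).2 (abs_nonneg _)
    · have h0 : β₀ k = 0 := hS k (Finset.mem_compl.1 hk)
      have h1 : β k = Δ k := by rw [← hΔk, h0, sub_zero]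
      rw [h0, h1, mul_zero, abs_zero, zero_sub, neg_le_neg_iff]
      by_cases h0 : Δ k = 0
      · simp [h0]
      · rw [abs_mul, abs_of_nonneg (by linarith [(hw k h0).1] : 0 ≤ w k)]
        exact le_mul_of_one_le_left (abs_nonneg _) (hw k h0).1
  -- The score enters twice, with weight `μ / 4`, so it uses up half of the ℓ¹ penalty on the error.
  -- The other half stays on the right as `-(x + y) / 2`; it yields both the cone condition and the
  -- final bound.
  have hbasic : Z ≤ μ * ((r + 1) * x - (x + y) / 2) := by
    have := mul_le_mul_of_nonneg_left hpen hμ.le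
    nlinarith
  have hZ0 : 0 ≤ Z := hpsd Δ
  have hcone : x + y ≤ 2 * (1 + r) * x := by
    have h2 : 0 ≤ (r + 1) * x - (x + y) / 2 := nonneg_of_mul_nonneg_right (hZ0.trans hbasic) hμ
    linarith
  set N := ∑ k ∈ S, Δ k ^ 2 with hN
  have hN0 : 0 ≤ N := Finset.sum_nonneg fun _ _ => sq_nonneg _
  have hs0 : 0 ≤ s := (Nat.cast_nonneg _).trans hs
  have hCS : x ^ 2 ≤ s * N := by
    have := sq_sum_le_card_mul_sum_sq (s := S) (f := fun k => |Δ k|)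
    simp only [sq_abs] at this
    exact this.trans (mul_le_mul_of_nonneg_right hs hN0)
  -- In the cone `(x + y)² ≤ 4(1 + r)² s N`, so the factor 8 in `hφ` makes the tolerance consume at
  -- most half of the curvature.
  have hφN : φ * (x + y) ^ 2 ≤ a / 2 * N := by
    rcases le_or_gt φ 0 with h | h
    · exact (mul_nonpos_of_nonpos_of_nonneg h (sq_nonneg _)).trans (by positivity)
    · have h1 : (x + y) ^ 2 ≤ (2 * (1 + r) * x) ^ 2 := pow_le_pow_left₀ (by positivity) hcone 2
      have h2 : (x + y) ^ 2 ≤ 4 * (1 + r) ^ 2 * (s * N) := by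
        nlinarith [mul_le_mul_of_nonneg_left hCS (sq_nonneg (1 + r))]
      have h3 := mul_le_mul_of_nonneg_left h2 h.le
      have h4 := mul_le_mul_of_nonneg_right hφ hN0
      nlinarith
  have hmain : a / 2 * N ≤ μ * ((r + 1) * x - (x + y) / 2) := by
    rw [hxy] at hRE; linarith
  rw [hxy]
  -- The last step cancels a factor `s * μ`, so `s = 0` is separate: there `x = 0` and the cone
  -- condition leaves nothing.
  rcases hs0.eq_or_lt with h | hspos
  · have hx00 : x = 0 := by
      rw [← h, zero_mul] at hCS
      exact pow_eq_zero_iff (two_ne_zero) |>.1 (le_antisymm hCS (sq_nonneg _))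
    rw [← h]
    rw [hx00] at hcone ⊢
    simp only [mul_zero, zero_div, zero_mul]
    linarith
  · have h5 : a * x ^ 2 ≤ s * (2 * μ * ((r + 1) * x - (x + y) / 2)) := by
      have := mul_le_mul_of_nonneg_left hCS ha.le
      have := mul_le_mul_of_nonneg_left hmain hspos.le
      nlinarith
    rw [div_mul_eq_mul_div, le_div_iff₀ ha]
    -- Completing the square in `x`: `s μ (x + y) ≤ 2 s μ (1 + r) x - a x²` is at most `(s μ (1 +
    -- r))² / a`.
    have h6 : 0 ≤ (a * x - s * μ * (1 + r)) ^ 2 := sq_nonneg _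
    have h7 := mul_le_mul_of_nonneg_left h5 ha.le
    have h8 : s * μ * ((x + y) * a) ≤ s * μ * ((1 + r) ^ 2 * s * μ) := by linarith
    exact le_of_mul_le_mul_left h8 (by positivity)

/-- A bounded-below continuous loss with a weighted `ℓ¹` penalty has a minimizer over vectors
with a prescribed pattern. -/
theorem exists_isMinOn_l1_penalty {f : (κ → ℝ) → ℝ} (hf : Continuous f) {b : ℝ}
    (hb : ∀ v, b ≤ f v) {w : κ → ℝ} {F : Set κ} (hw : ∀ k ∈ F, 1 ≤ w k) {μ : ℝ} (hμ : 0 < μ) :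
    ∃ β ∈ {β : κ → ℝ | ∀ k, β k ≠ 0 → k ∈ F},
      IsMinOn (fun β => f β + μ * ∑ k, |w k * β k|) {β : κ → ℝ | ∀ k, β k ≠ 0 → k ∈ F} β := by
  set D : Set (κ → ℝ) := {β : κ → ℝ | ∀ k, β k ≠ 0 → k ∈ F} with hD
  have hDc : IsClosed D := by
    have : D = ⋂ k, ⋂ (_ : k ∉ F), {β : κ → ℝ | β k = 0} := by
      ext β
      simp only [hD, Set.mem_ofPred_eq, Set.mem_iInter]
      exact forall_congr' fun k => not_imp_comm
    rw [this]
    exact isClosed_iInter fun k => isClosed_iInter fun _ =>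
      isClosed_eq (continuous_apply k) continuous_const
  have hcont : Continuous fun β : κ → ℝ => f β + μ * ∑ k, |w k * β k| := by fun_prop
  refine hcont.continuousOn.exists_isMinOn' hDc (x₀ := 0) (by simp [hD]) ?_
  rw [Filter.eventually_inf_principal]
  -- Beyond this radius the penalty, which dominates the sup norm because the weights are at least
  -- one, already exceeds `f 0 - b`, so the objective is above its value at zero.
  set R := (f 0 - b) / μ
  have hR : ∀ᶠ β in Filter.cocompact (κ → ℝ), R < ‖β‖ := by
    have := tendsto_norm_cocompact_atTop (E := κ → ℝ)
    exact this.eventually_gt_atTop R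
  filter_upwards [hR] with β hβ hβD
  have h1 : ‖β‖ ≤ ∑ k, |w k * β k| := by
    refine (pi_norm_le_iff_of_nonneg (Finset.sum_nonneg fun _ _ => abs_nonneg _)).2 fun k => ?_
    refine le_trans ?_ (Finset.single_le_sum (f := fun k => |w k * β k|)
      (fun _ _ => abs_nonneg _) (Finset.mem_univ k))
    by_cases h0 : β k = 0
    · simp [h0]
    · have := hw k (hβD k h0)
      rw [abs_mul, Real.norm_eq_abs, abs_of_nonneg (by linarith : 0 ≤ w k)]
      exact le_mul_of_one_le_left (abs_nonneg _) this
  have h2 : f 0 - b ≤ μ * ∑ k, |w k * β k| := by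
    have : R < ∑ k, |w k * β k| := hβ.trans_le h1
    rw [div_lt_iff₀ hμ] at this
    linarith
  have := hb β
  simp only [Pi.zero_apply, mul_zero, abs_zero, Finset.sum_const_zero, add_zero]
  linarith

end Lasso

/-! ### The empirical method of Maurey -/

section Maurey

variable {ι : Type*}

/-- A sum of `k` signed basis vectors. -/
def signedSum [DecidableEq ι] {k : ℕ} (f : Fin k → ι × Bool) : ι → ℝ :=
  ∑ l, Pi.single (f l).1 (if (f l).2 then 1 else -1)

lemma exists_le_of_weighted_sum [Fintype ι] {p Φ : ι → ℝ} (hp : ∀ j, 0 ≤ p j) (hp1 : ∑ j, p j = 1) :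
    ∃ j, Φ j ≤ ∑ j, p j * Φ j := by
  by_contra! h
  have hne : ∃ j, 0 < p j := by
    by_contra! h0
    have : ∑ j, p j ≤ 0 := Finset.sum_nonpos fun j _ => h0 j
    linarith
  obtain ⟨j₀, hj₀⟩ := hne
  have : ∑ j, p j * (∑ j, p j * Φ j) < ∑ j, p j * Φ j :=
    Finset.sum_lt_sum (fun j _ => mul_le_mul_of_nonneg_left (h j).le (hp j))
      ⟨j₀, Finset.mem_univ _, mul_lt_mul_of_pos_left (h j₀) hj₀⟩
  rw [← Finset.sum_mul, hp1, one_mul] at this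
  exact lt_irrefl _ this

variable [Fintype ι] [DecidableEq ι]

/-- For independent signed basis vectors with mean `v`, the expected form of their sum is `k(k-1)
v'Mv` plus `k` times an average of diagonal entries. The induction derandomizes this by conditional
expectations: the right side is the expected value given the partial sum `u`, and each choice does
at least as well as the average. -/
lemma exists_signedSum_le {M : Matrix ι ι ℝ} (hM : M.IsSymm) {K : ℝ} (hK : ∀ j, M j j ≤ K)
    {v : ι → ℝ} (hv : ∑ j, |v j| = 1) (k : ℕ) (u : ι → ℝ) :
    ∃ f : Fin k → ι × Bool,
      (u + signedSum f) ⬝ᵥ (M *ᵥ (u + signedSum f)) ≤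
        u ⬝ᵥ (M *ᵥ u) + 2 * k * (u ⬝ᵥ (M *ᵥ v)) + k * (k - 1) * (v ⬝ᵥ (M *ᵥ v)) + k * K := by
  induction k generalizing u with
  | zero => exact ⟨Fin.elim0, by simp [signedSum]⟩
  | succ k ih =>
    -- The sign of `v j` is attached to the basis vector, so that the weights `|v j|` average these
    -- vectors to `v`.
    set e : ι → ι → ℝ := fun j => Pi.single j (if 0 ≤ v j then 1 else -1) with he
    set Φ : (ι → ℝ) → ℝ := fun u => u ⬝ᵥ (M *ᵥ u) + 2 * k * (u ⬝ᵥ (M *ᵥ v)) +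
      k * (k - 1) * (v ⬝ᵥ (M *ᵥ v)) + k * K with hΦ
    obtain ⟨j, hj⟩ := exists_le_of_weighted_sum (Φ := fun j => Φ (u + e j))
      (fun j => abs_nonneg (v j)) hv
    obtain ⟨f, hf⟩ := ih (u + e j)
    refine ⟨Fin.cons (j, decide (0 ≤ v j)) f, ?_⟩
    have hsum : signedSum (Fin.cons (j, decide (0 ≤ v j)) f : Fin (k + 1) → ι × Bool) =
        e j + signedSum f := by
      simp [signedSum, Fin.sum_univ_succ, he]
    rw [hsum, ← add_assoc]
    refine hf.trans (hj.trans ?_)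
    have hes : ∀ j, |v j| • e j = Pi.single j (v j) := by
      intro j
      rw [he, ← Pi.single_smul]
      congr 1
      split_ifs with h
      · simp [abs_of_nonneg h]
      · simp [abs_of_neg (not_le.1 h)]
    have hvsum : ∑ j, |v j| • e j = v := by
      simp_rw [hes]
      exact Finset.univ_sum_single v
    have hdiag : ∀ j, e j ⬝ᵥ (M *ᵥ e j) = M j j := by
      intro j
      simp only [he, single_dotProduct, Matrix.mulVec_single]
      split_ifs <;> simp
    have hlin : ∀ c : ι → ℝ, ∑ j, |v j| * (e j ⬝ᵥ c) = v ⬝ᵥ c := by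
      intro c
      conv_rhs => rw [← hvsum, sum_dotProduct]
      simp only [smul_dotProduct, smul_eq_mul]
    have hexp : ∀ j, Φ (u + e j) = Φ u + 2 * (e j ⬝ᵥ (M *ᵥ u)) + M j j +
        2 * k * (e j ⬝ᵥ (M *ᵥ v)) := by
      intro j
      simp only [hΦ]
      rw [quadratic_expand hM (u + e j) u]
      simp only [add_sub_cancel_left, hdiag, add_dotProduct]
      ring
    have hbound : ∑ j, |v j| * Φ (u + e j) ≤ Φ u + 2 * (v ⬝ᵥ (M *ᵥ u)) + K +
        2 * k * (v ⬝ᵥ (M *ᵥ v)) := by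
      calc ∑ j, |v j| * Φ (u + e j) ≤ ∑ j, (|v j| * (Φ u + K) +
            2 * (|v j| * (e j ⬝ᵥ (M *ᵥ u))) + 2 * k * (|v j| * (e j ⬝ᵥ (M *ᵥ v)))) := by
            refine Finset.sum_le_sum fun j _ => ?_
            rw [hexp]
            nlinarith [mul_le_mul_of_nonneg_left (hK j) (abs_nonneg (v j))]
        _ = _ := by
            rw [Finset.sum_add_distrib, Finset.sum_add_distrib, ← Finset.sum_mul,
              ← Finset.mul_sum, ← Finset.mul_sum, hlin, hlin, hv]
            ring
    refine hbound.trans (le_of_eq ?_)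
    have hsym : v ⬝ᵥ (M *ᵥ u) = u ⬝ᵥ (M *ᵥ v) := by
      rw [Matrix.dotProduct_mulVec, ← Matrix.mulVec_transpose, hM.eq, dotProduct_comm]
    simp only [hΦ, hsym]
    push_cast
    ring

/-- A quadratic form which is nonnegative on all sums of `k` signed basis vectors is bounded below
by a small multiple of the squared `ℓ¹` norm. -/
theorem quadratic_lower_of_signedSum {M : Matrix ι ι ℝ} (hM : M.IsSymm) {K : ℝ}
    (hK : ∀ j, M j j ≤ K) {k : ℕ} (hk : 2 ≤ k)
    (hpos : ∀ f : Fin k → ι × Bool, 0 ≤ signedSum f ⬝ᵥ (M *ᵥ signedSum f)) (v : ι → ℝ) :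
    -(K / (k - 1)) * (∑ j, |v j|) ^ 2 ≤ v ⬝ᵥ (M *ᵥ v) := by
  rcases (Finset.sum_nonneg fun j (_ : j ∈ Finset.univ) => abs_nonneg (v j)).eq_or_lt with h | h
  · have : v = 0 := by
      ext j
      exact abs_eq_zero.1 ((Finset.sum_eq_zero_iff_of_nonneg fun j _ => abs_nonneg (v j)).1
        h.symm j (Finset.mem_univ j))
    simp [this]
  · set n := ∑ j, |v j|
    have hn : ∑ j, |(n⁻¹ • v) j| = 1 := by
      simp only [Pi.smul_apply, smul_eq_mul, abs_mul, ← Finset.mul_sum, abs_inv, abs_of_pos h]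
      exact inv_mul_cancel₀ h.ne'
    obtain ⟨f, hf⟩ := exists_signedSum_le hM hK hn k 0
    simp only [zero_add, Matrix.mulVec_zero, zero_dotProduct, mul_zero, Matrix.mulVec_smul,
      dotProduct_smul, smul_dotProduct, smul_eq_mul] at hf
    have h0 := (hpos f).trans hf
    have hk1 : (0 : ℝ) < k - 1 := by
      have : (2 : ℝ) ≤ k := by exact_mod_cast hk
      linarith
    have hk0 : (0 : ℝ) < k := by linarith
    have h1 : 0 ≤ (k : ℝ) * ((k - 1) * (v ⬝ᵥ (M *ᵥ v)) + K * n ^ 2) := by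
      have := mul_nonneg h0 (sq_nonneg n)
      have e : (k * (k - 1) * (n⁻¹ * (n⁻¹ * v ⬝ᵥ (M *ᵥ v))) + k * K) * n ^ 2 =
        (k : ℝ) * ((k - 1) * (v ⬝ᵥ (M *ᵥ v)) + K * n ^ 2) := by
        field_simp
      linarith
    have h2 := nonneg_of_mul_nonneg_right h1 hk0
    rw [neg_mul, div_mul_eq_mul_div, neg_le_iff_add_nonneg, ← sub_nonneg]
    have : v ⬝ᵥ (M *ᵥ v) + K * n ^ 2 / (k - 1) =
      ((k - 1) * (v ⬝ᵥ (M *ᵥ v)) + K * n ^ 2) / (k - 1) := by field_simp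
    rw [this, sub_zero]
    exact div_nonneg h2 hk1.le

end Maurey

/-! ### The Gram matrix and the cross moments of a trajectory -/

section Design

variable {m p : ℕ} {T : ℕ} {x : ℤ → (Fin m × Fin p → ℝ)} {G : Matrix (Fin m) (Fin m) ℝ}

/-- The coefficients with which the predictors enter the regression of variable `i` at
location `s`. -/
def rowCoeff (G : Matrix (Fin m) (Fin m) ℝ) (v : Idx m p → ℝ) (s : Fin p) (i : Fin m) :
    Fin m × Fin p → ℝ :=
  fun b => G i b.1 * v (s, (i, b.1, b.2))

lemma design_mulVec (c : Fin m × Fin m × Fin p → ℝ) (a : Fin m × Fin T) :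
    (design T x G *ᵥ c) a =
      (fun b : Fin m × Fin p => G a.1 b.1 * c (a.1, b.1, b.2)) ⬝ᵥ x (a.2 : ℕ) := by
  simp only [Matrix.mulVec, dotProduct, design, Matrix.of_apply]
  rw [Fintype.sum_prod_type, Finset.sum_eq_single a.1]
  · simp only [if_true]
    exact Finset.sum_congr rfl fun b _ => by ring
  · intro i _ hi
    exact Finset.sum_eq_zero fun b _ => by simp [Ne.symm hi]
  · simp

lemma design_transpose_mulVec (z : Fin m × Fin T → ℝ) (b : Fin m × Fin m × Fin p) :
    ((design T x G)ᵀ *ᵥ z) b =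
      G b.1 b.2.1 * ∑ t : Fin T, x (t : ℕ) (b.2.1, b.2.2) * z (b.1, t) := by
  simp only [Matrix.mulVec, dotProduct, design, Matrix.transpose_apply, Matrix.of_apply]
  rw [Fintype.sum_prod_type, Finset.sum_eq_single b.1]
  · simp only [if_true, Finset.mul_sum]
    exact Finset.sum_congr rfl fun t _ => by ring
  · intro i _ hi
    exact Finset.sum_eq_zero fun t _ => by simp [hi]
  · simp

lemma one_kronecker_mulVec {κ κ' : Type*} [Fintype κ'] (N : Matrix κ κ' ℝ)
    (v : Fin p × κ' → ℝ) (s : Fin p) (b : κ) :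
    (((1 : Matrix (Fin p) (Fin p) ℝ) ⊗ₖ N) *ᵥ v) (s, b) = (N *ᵥ fun b' => v (s, b')) b := by
  simp only [Matrix.mulVec, dotProduct, Matrix.kroneckerMap_apply, Matrix.one_apply]
  rw [Fintype.sum_prod_type, Finset.sum_eq_single s]
  · simp
  · intro s' _ hs
    exact Finset.sum_eq_zero fun b _ => by simp [Ne.symm hs]
  · simp

lemma gram_mulVec (v : Idx m p → ℝ) (k : Idx m p) :
    (gram T x G *ᵥ v) k = (T : ℝ)⁻¹ *
      ((design T x G)ᵀ *ᵥ (design T x G *ᵥ fun b => v (k.1, b))) k.2 := by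
  obtain ⟨s, b⟩ := k
  rw [gram, one_kronecker_mulVec, Matrix.smul_mulVec, Matrix.mulVec_mulVec]
  simp

lemma crossMoment_apply (k : Idx m p) :
    crossMoment T x G k = (T : ℝ)⁻¹ *
      ((design T x G)ᵀ *ᵥ fun a => response T x a k.1) k.2 := by
  obtain ⟨s, b⟩ := k
  simp only [crossMoment, Pi.smul_apply, one_kronecker_mulVec, smul_eq_mul, Matrix.vec]

lemma gram_isSymm : (gram T x G).IsSymm := by
  rw [Matrix.IsSymm, gram, ← Matrix.kroneckerMap_transpose, Matrix.transpose_one,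
    Matrix.transpose_smul, Matrix.transpose_mul, Matrix.transpose_transpose]

lemma dotProduct_gram_mulVec (u v : Idx m p → ℝ) :
    u ⬝ᵥ (gram T x G *ᵥ v) = ∑ s, (T : ℝ)⁻¹ *
      ((design T x G *ᵥ fun b => u (s, b)) ⬝ᵥ (design T x G *ᵥ fun b => v (s, b))) := by
  rw [dotProduct, Fintype.sum_prod_type]
  refine Finset.sum_congr rfl fun s _ => ?_
  simp only [gram_mulVec]
  rw [← Matrix.vecMul_transpose (design T x G) fun b => u (s, b), ← Matrix.dotProduct_mulVec,
    dotProduct, Finset.mul_sum]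
  exact Finset.sum_congr rfl fun b _ => by ring

lemma dotProduct_crossMoment (v : Idx m p → ℝ) :
    v ⬝ᵥ crossMoment T x G = ∑ s, (T : ℝ)⁻¹ *
      ((design T x G *ᵥ fun b => v (s, b)) ⬝ᵥ fun a => response T x a s) := by
  rw [dotProduct, Fintype.sum_prod_type]
  refine Finset.sum_congr rfl fun s _ => ?_
  simp only [crossMoment_apply]
  rw [← Matrix.vecMul_transpose (design T x G) fun b => v (s, b), ← Matrix.dotProduct_mulVec,
    dotProduct, Finset.mul_sum]
  exact Finset.sum_congr rfl fun b _ => by ring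

lemma gram_nonneg (v : Idx m p → ℝ) : 0 ≤ v ⬝ᵥ (gram T x G *ᵥ v) := by
  rw [dotProduct_gram_mulVec]
  refine Finset.sum_nonneg fun s _ => mul_nonneg (by positivity) ?_
  exact Finset.sum_nonneg fun a _ => mul_self_nonneg _

/-- The identity factor separates the locations `s`, and the block diagonal design separates the
response variables `i`; what remains for each pair is an ordinary sample second moment. -/
lemma gram_quadratic (v : Idx m p → ℝ) :
    v ⬝ᵥ (gram T x G *ᵥ v) =
      ∑ s, ∑ i, (T : ℝ)⁻¹ * ∑ t : Fin T, (rowCoeff G v s i ⬝ᵥ x (t : ℕ)) ^ 2 := by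
  rw [dotProduct_gram_mulVec]
  refine Finset.sum_congr rfl fun s _ => ?_
  rw [dotProduct, Fintype.sum_prod_type, Finset.mul_sum]
  refine Finset.sum_congr rfl fun i _ => ?_
  congr 1
  refine Finset.sum_congr rfl fun t _ => ?_
  rw [design_mulVec, ← sq]
  rfl

/-- The loss is a residual sum of squares minus the part that does not depend on `v`; this supplies
the lower bound needed for existence of a minimizer. -/
lemma smooth_loss_bounded_below (v : Idx m p → ℝ) :
    -∑ s, (T : ℝ)⁻¹ * ∑ a, response T x a s ^ 2 ≤
      -2 * (v ⬝ᵥ crossMoment T x G) + v ⬝ᵥ (gram T x G *ᵥ v) := by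
  rw [dotProduct_crossMoment, dotProduct_gram_mulVec, Finset.mul_sum, ← Finset.sum_add_distrib,
    ← Finset.sum_neg_distrib]
  refine Finset.sum_le_sum fun s _ => ?_
  set f := design T x G *ᵥ fun b => v (s, b)
  have h : 0 ≤ (T : ℝ)⁻¹ * ∑ a, (f a - response T x a s) ^ 2 :=
    mul_nonneg (by positivity) (Finset.sum_nonneg fun _ _ => sq_nonneg _)
  have e : ∑ a, (f a - response T x a s) ^ 2 =
      f ⬝ᵥ f - 2 * (f ⬝ᵥ fun a => response T x a s) + ∑ a, response T x a s ^ 2 := by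
    simp only [dotProduct, Finset.mul_sum, ← Finset.sum_sub_distrib, ← Finset.sum_add_distrib]
    exact Finset.sum_congr rfl fun a _ => by ring
  rw [e] at h
  linarith

theorem exists_thetaUpdate {J0 : Set (Fin p × Fin p)} {r : ℝ} {w : Matrix (Fin p) (Fin p) ℝ}
    (hw : AdmissibleWeights J0 r w) {μ : ℝ} (hμ : 0 < μ) :
    ∃ β, IsThetaUpdate T x G J0 w μ β := by
  have hc : Continuous fun v : Idx m p → ℝ =>
      -2 * (v ⬝ᵥ crossMoment T x G) + v ⬝ᵥ (gram T x G *ᵥ v) := by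
    simp only [Matrix.mulVec, dotProduct]
    fun_prop
  obtain ⟨β, h1, h2⟩ := exists_isMinOn_l1_penalty hc smooth_loss_bounded_below
    (w := fun k : Idx m p => w k.1 k.2.2.2) (F := {k : Idx m p | (k.1, k.2.2.2) ∈ J0})
    (fun k hk => (hw _ _ hk).1) hμ
  exact ⟨β, h1, h2⟩

end Design

/-! ### Sparsity of the true parameter and the deterministic error bound -/

section Deterministic

variable {m p : ℕ} {J0 : Set (Fin p × Fin p)} {sG sT : ℕ} {g CG : ℝ}
  {G : Matrix (Fin m) (Fin m) ℝ} {Th : Fin m → Fin m → Matrix (Fin p) (Fin p) ℝ}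

open Classical in
/-- Coordinates of the nonzero entries of the spatial parameters. -/
def thetaSupport (Th : Fin m → Fin m → Matrix (Fin p) (Fin p) ℝ) : Finset (Idx m p) :=
  Finset.univ.filter fun k => Th k.2.1 k.2.2.1 k.1 k.2.2.2 ≠ 0

lemma mem_thetaSupport {k : Idx m p} :
    k ∈ thetaSupport Th ↔ Th k.2.1 k.2.2.1 k.1 k.2.2.2 ≠ 0 := by
  simp [thetaSupport]

lemma betaTheta_apply (k : Idx m p) : betaTheta Th k = Th k.2.1 k.2.2.1 k.1 k.2.2.2 := rfl

lemma TrueParams.gamma_ne_zero (h : TrueParams J0 sG sT g CG G Th) {i j : Fin m} {s s' : Fin p}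
    (hne : Th i j s s' ≠ 0) : G i j ≠ 0 := fun h0 => hne (by simp [h.inactive i j h0])

lemma TrueParams.card_thetaSupport_le (h : TrueParams J0 sG sT g CG G Th) :
    (thetaSupport Th).card ≤ sG * sT := by
  classical
  rw [mul_comm]
  refine (Finset.card_le_mul_card_image (f := fun k : Idx m p => (k.2.1, k.2.2.1))
    (thetaSupport Th) sT ?_).trans (Nat.mul_le_mul_left _ ?_)
  · rintro ⟨i, j⟩ -
    refine le_trans ?_ (h.sparse_Th i j)
    rw [Set.ncard_eq_toFinset_card']
    refine Finset.card_le_card_of_injOn (fun k => (k.1, k.2.2.2)) ?_ ?_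
    · rintro ⟨s, i', j', s'⟩ hk
      simp only [Finset.coe_filter, mem_thetaSupport, Set.mem_ofPred_eq, Prod.mk.injEq] at hk
      obtain ⟨h1, rfl, rfl⟩ := hk
      simpa using h1
    · rintro ⟨s, i', j', s'⟩ hk ⟨s₂, i₂, j₂, s₂'⟩ hk₂ he
      simp only [Finset.coe_filter, mem_thetaSupport, Set.mem_ofPred_eq, Prod.mk.injEq] at hk hk₂ he
      simp [hk.2.1, hk.2.2, hk₂.2.1, hk₂.2.2, he.1, he.2]
  · refine le_trans ?_ h.sparse_G
    rw [Set.ncard_eq_toFinset_card']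
    refine Finset.card_le_card fun e he => ?_
    obtain ⟨k, hk, rfl⟩ := Finset.mem_image.1 he
    simpa using h.gamma_ne_zero (mem_thetaSupport.1 hk)

lemma TrueParams.thetaSupport_subset (h : TrueParams J0 sG sT g CG G Th) :
    thetaSupport Th ⊆ activeCoords G := fun k hk => by
  simpa [activeCoords] using h.gamma_ne_zero (mem_thetaSupport.1 hk)

lemma TrueParams.abs_le_one (h : TrueParams J0 sG sT g CG G Th) (i j : Fin m) (s s' : Fin p) :
    |Th i j s s'| ≤ 1 := by
  by_cases hne : Th i j s s' = 0
  · simp [hne]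
  · have h1 := h.normalized i j (h.gamma_ne_zero hne)
    rw [← sq_le_one_iff_abs_le_one, ← h1]
    exact (Finset.single_le_sum (f := fun s' => Th i j s s' ^ 2) (fun _ _ => sq_nonneg _)
      (Finset.mem_univ s')).trans (Finset.single_le_sum (f := fun s => ∑ s', Th i j s s' ^ 2)
      (fun _ _ => Finset.sum_nonneg fun _ _ => sq_nonneg _) (Finset.mem_univ s))

/-- Frobenius normalization bounds each entry by one, and a row has no more nonzero entries than the
whole support. This controls how an error in `Ghat` is propagated through the spatial blocks. -/
lemma TrueParams.sum_abs_row_le (h : TrueParams J0 sG sT g CG G Th) (i : Fin m) (s : Fin p) :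
    ∑ b : Fin m × Fin p, |Th i b.1 s b.2| ≤ sG * sT := by
  classical
  have h1 : ∑ b : Fin m × Fin p, |Th i b.1 s b.2| ≤
      ∑ b : Fin m × Fin p, if Th i b.1 s b.2 ≠ 0 then (1 : ℝ) else 0 := by
    refine Finset.sum_le_sum fun b _ => ?_
    split_ifs with hb
    · exact h.abs_le_one _ _ _ _
    · simp [not_not.1 hb]
  refine h1.trans ?_
  rw [← Finset.sum_filter, Finset.sum_const, nsmul_eq_mul, mul_one]
  have h2 : (Finset.univ.filter fun b : Fin m × Fin p => Th i b.1 s b.2 ≠ 0).card ≤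
      (thetaSupport Th).card := by
    refine Finset.card_le_card_of_injOn (fun b => (s, (i, b.1, b.2))) ?_ ?_
    · intro b hb
      simpa [mem_thetaSupport] using hb
    · intro b _ b' _ hbb
      simp only [Prod.mk.injEq, true_and] at hbb
      exact Prod.ext hbb.1 hbb.2
  exact_mod_cast h2.trans h.card_thetaSupport_le

lemma TrueParams.betaTheta_mem_feasible (h : TrueParams J0 sG sT g CG G Th) :
    betaTheta Th ∈ feasible J0 := fun _ hk => h.support _ _ _ _ hk

/-- The error bound on the event of the restricted eigenvalue condition and the deviation
bound. -/
theorem TrueParams.errorBound (h : TrueParams J0 sG sT g CG G Th) {r : ℝ} (hr : 1 ≤ r)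
    {w : Matrix (Fin p) (Fin p) ℝ} (hw : AdmissibleWeights J0 r w) {T : ℕ}
    {x : ℤ → (Fin m × Fin p → ℝ)} {Ghat : Matrix (Fin m) (Fin m) ℝ} {A : Finset (Idx m p)}
    {a φ q μ : ℝ} (hA : activeCoords G ⊆ A) (ha : 0 < a)
    (hφ : 8 * (1 + r) ^ 2 * sG * sT * φ ≤ a)
    (hRE : RestrictedEigenvalue (gram T x Ghat) A a φ)
    (hdev : DeviationBound T x Ghat (betaTheta Th) q) (hμ : 0 < μ)
    (hqμ : 4 * q * √((Real.log m + Real.log p) / T) ≤ μ) {β : Idx m p → ℝ}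
    (hβ : IsThetaUpdate T x Ghat J0 w μ β) :
    ErrorBound β (betaTheta Th) r sG sT a μ := by
  have hfeas := h.betaTheta_mem_feasible
  have key : ∑ k, |β k - betaTheta Th k| ≤ (1 + r) ^ 2 * ((sG : ℝ) * sT) / a * μ := by
    refine lasso_error (M := gram T x Ghat) gram_isSymm gram_nonneg (γ := crossMoment T x Ghat)
      (w := fun k => w k.1 k.2.2.2) (S := thetaSupport Th) (φ := φ)
      (by exact_mod_cast h.card_thetaSupport_le)
      (fun k hk => not_not.1 fun h0 => hk (mem_thetaSupport.2 h0)) ha hμ (by linarith) ?_ ?_ ?_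
      (hβ.2 hfeas)
    · intro k hk
      have : (k.1, k.2.2.2) ∈ J0 := by
        by_contra hJ
        have h1 : β k = 0 := not_not.1 fun h0 => hJ (hβ.1 k h0)
        have h2 : betaTheta Th k = 0 := not_not.1 fun h0 => hJ (hfeas k h0)
        exact hk (by rw [h1, h2, sub_zero])
      exact hw _ _ this
    · intro k
      have := hdev k
      rw [add_comm (Real.log p)] at this
      linarith
    · refine le_trans ?_ (hRE (β - betaTheta Th))
      refine sub_le_sub_right (mul_le_mul_of_nonneg_left ?_ ha.le) _
      exact Finset.sum_le_sum_of_subset_of_nonneg (h.thetaSupport_subset.trans hA)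
        fun _ _ _ => sq_nonneg _
  refine key.trans ?_
  rw [div_mul_eq_mul_div, div_mul_eq_mul_div, div_mul_eq_mul_div]
  refine div_le_div_of_nonneg_right ?_ ha.le
  rw [← mul_assoc]
  refine mul_le_mul_of_nonneg_right (mul_le_mul_of_nonneg_right ?_ (by positivity)) hμ.le
  -- It remains that `(1 + r)² sG ≤ 2 + 6 r sG + 4 r² sG²`, which for `sG ≥ 1` follows from `sG ≤
  -- sG²` and `sG ≤ r sG`.
  rcases Nat.eq_zero_or_pos sG with h0 | h0
  · simp [h0]
  · have h1 : (1 : ℝ) ≤ sG := by exact_mod_cast h0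
    have h2 : (sG : ℝ) ≤ (sG : ℝ) ^ 2 := by nlinarith
    have h3 : r ^ 2 * (sG : ℝ) ≤ r ^ 2 * (sG : ℝ) ^ 2 := mul_le_mul_of_nonneg_left h2 (sq_nonneg r)
    have h4 : (sG : ℝ) ≤ r * sG := le_mul_of_one_le_left (by linarith) hr
    nlinarith [mul_nonneg (sq_nonneg r) (sq_nonneg (sG : ℝ))]

end Deterministic

/-! ### Transfer of conditions from the sample covariance -/

section Transfer

variable {m p : ℕ} {J0 : Set (Fin p × Fin p)} {sG sT : ℕ} {g CG : ℝ}
  {G Ghat : Matrix (Fin m) (Fin m) ℝ} {Th : Fin m → Fin m → Matrix (Fin p) (Fin p) ℝ}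
  {T : ℕ} {x : ℤ → (Fin m × Fin p → ℝ)}

/-- A restricted eigenvalue bound for the sample covariance is inherited by the Gram matrix of
the weighted design on the active coordinates. -/
theorem TrueParams.restrictedEigenvalue_gram (h : TrueParams J0 sG sT g CG G Th) (hg : 0 < g)
    {θ ψ : ℝ} (hθ : 0 ≤ θ) (hψ : 0 ≤ ψ) (hclose : ∀ i j, |Ghat i j - G i j| ≤ g / 2)
    (hx : ∀ u : Fin m × Fin p → ℝ, θ * ∑ b, u b ^ 2 - ψ * (∑ b, |u b|) ^ 2 ≤
      (T : ℝ)⁻¹ * ∑ t : Fin T, (u ⬝ᵥ x (t : ℕ)) ^ 2) :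
    RestrictedEigenvalue (gram T x Ghat) (activeCoords G) (θ * (g / 2) ^ 2)
      (ψ * (|CG| + g / 2) ^ 2) := by
  classical
  intro v
  rw [gram_quadratic]
  have hub : ∀ i j, |Ghat i j| ≤ |CG| + g / 2 := fun i j => by
    have h1 := abs_add_le (G i j) (Ghat i j - G i j)
    rw [add_sub_cancel] at h1
    linarith [hclose i j, h.upper_G i j, le_abs_self CG]
  have hlb : ∀ i j, G i j ≠ 0 → g / 2 ≤ |Ghat i j| := fun i j h0 => by
    have h1 := abs_add_le (Ghat i j) (G i j - Ghat i j)
    rw [add_sub_cancel, abs_sub_comm (G i j)] at h1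
    linarith [hclose i j, h.lower_G i j h0]
  refine le_trans ?_ (Finset.sum_le_sum fun s _ => Finset.sum_le_sum fun i _ =>
    hx (rowCoeff Ghat v s i))
  simp only [Finset.sum_sub_distrib, ← Finset.mul_sum]
  refine sub_le_sub ?_ ?_
  · rw [mul_assoc]
    refine mul_le_mul_of_nonneg_left ?_ hθ
    rw [activeCoords, Finset.sum_filter, Finset.mul_sum, Fintype.sum_prod_type]
    refine Finset.sum_le_sum fun s _ => ?_
    rw [Fintype.sum_prod_type]
    refine Finset.sum_le_sum fun i _ => Finset.sum_le_sum fun b _ => ?_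
    split_ifs with h0
    · simp only [rowCoeff, mul_pow]
      refine mul_le_mul_of_nonneg_right ?_ (sq_nonneg _)
      rw [← sq_abs (Ghat i b.1)]
      exact pow_le_pow_left₀ (by positivity) (hlb i b.1 h0) 2
    · rw [mul_zero]; exact sq_nonneg _
  · rw [mul_assoc]
    refine mul_le_mul_of_nonneg_left ?_ hψ
    -- The ℓ¹ norms of the separate regressions add up to the full one, and a sum of squares of
    -- nonnegative numbers is at most the square of their sum, so no factor counting the regressions
    -- appears.
    set N : Fin p → Fin m → ℝ := fun s i => ∑ b : Fin m × Fin p, |v (s, (i, b))| with hN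
    have hN0 : ∀ s i, 0 ≤ N s i := fun s i => Finset.sum_nonneg fun _ _ => abs_nonneg _
    have h1 : ∀ s i, (∑ b, |rowCoeff Ghat v s i b|) ^ 2 ≤ (|CG| + g / 2) ^ 2 * N s i ^ 2 := by
      intro s i
      rw [← mul_pow]
      refine pow_le_pow_left₀ (Finset.sum_nonneg fun _ _ => abs_nonneg _) ?_ 2
      rw [hN, Finset.mul_sum]
      refine Finset.sum_le_sum fun b _ => ?_
      rw [rowCoeff, abs_mul]
      exact mul_le_mul_of_nonneg_right (hub _ _) (abs_nonneg _)
    refine (Finset.sum_le_sum fun s _ => Finset.sum_le_sum fun i _ => h1 s i).trans ?_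
    simp only [← Finset.mul_sum]
    refine mul_le_mul_of_nonneg_left ?_ (sq_nonneg _)
    have h2 : ∑ k, |v k| = ∑ s, ∑ i, N s i := by
      rw [Fintype.sum_prod_type]
      exact Finset.sum_congr rfl fun s _ => Fintype.sum_prod_type _
    rw [h2]
    refine (Finset.sum_le_sum fun s _ => Finset.sum_sq_le_sq_sum_of_nonneg
      fun i _ => hN0 s i).trans ?_
    exact Finset.sum_sq_le_sq_sum_of_nonneg fun s _ => Finset.sum_nonneg fun i _ => hN0 s i

/-- The deviation bound on the event that the noise is nearly uncorrelated with the predictors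
and the sample variances are bounded. -/
theorem TrueParams.abs_crossMoment_sub_le (h : TrueParams J0 sG sT g CG G Th)
    {ε : ℤ → (Fin m × Fin p → ℝ)}
    (hrec : ∀ t, x t = transition G Th *ᵥ x (t - 1) + ε t) {ν K δ : ℝ} (hν : 0 ≤ ν)
    (hclose : ∀ i j, |Ghat i j - G i j| ≤ ν)
    (hK : ∀ b, (T : ℝ)⁻¹ * ∑ t : Fin T, x (t : ℕ) b ^ 2 ≤ K)
    (hδ : ∀ b b', |(T : ℝ)⁻¹ * ∑ t : Fin T, x (t : ℕ) b * ε ((t : ℕ) + 1) b'| ≤ δ)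
    (k : Idx m p) :
    |crossMoment T x Ghat k - (gram T x Ghat *ᵥ betaTheta Th) k| ≤
      (|CG| + ν) * (δ + ν * (sG * sT * K)) := by
  obtain ⟨s, i, j, s'⟩ := k
  set a : Fin m × Fin p := (j, s')
  have hub : |Ghat i j| ≤ |CG| + ν := by
    have h1 := abs_add_le (G i j) (Ghat i j - G i j)
    rw [add_sub_cancel] at h1
    linarith [hclose i j, h.upper_G i j, le_abs_self CG]
  have hcov : ∀ b, |(T : ℝ)⁻¹ * ∑ t : Fin T, x (t : ℕ) a * x (t : ℕ) b| ≤ K := by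
    intro b
    have h1 : ∀ t : Fin T, |x (t : ℕ) a * x (t : ℕ) b| ≤
        (x (t : ℕ) a ^ 2 + x (t : ℕ) b ^ 2) / 2 := fun t => by
      rw [abs_le]
      constructor <;> nlinarith [sq_nonneg (x (t : ℕ) a + x (t : ℕ) b),
        sq_nonneg (x (t : ℕ) a - x (t : ℕ) b)]
    rw [abs_mul, abs_of_nonneg (by positivity : (0 : ℝ) ≤ (T : ℝ)⁻¹)]
    calc (T : ℝ)⁻¹ * |∑ t : Fin T, x (t : ℕ) a * x (t : ℕ) b|
        ≤ (T : ℝ)⁻¹ * ∑ t : Fin T, (x (t : ℕ) a ^ 2 + x (t : ℕ) b ^ 2) / 2 :=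
          mul_le_mul_of_nonneg_left ((Finset.abs_sum_le_sum_abs _ _).trans
            (Finset.sum_le_sum fun t _ => h1 t)) (by positivity)
      _ = ((T : ℝ)⁻¹ * ∑ t : Fin T, x (t : ℕ) a ^ 2 +
            (T : ℝ)⁻¹ * ∑ t : Fin T, x (t : ℕ) b ^ 2) / 2 := by
          rw [← Finset.sum_div, Finset.sum_add_distrib]; ring
      _ ≤ K := by linarith [hK a, hK b]
  -- The residual at the true `Θ` but with the wrong `Γ`: the noise plus a misspecification linear
  -- in `G - Ghat`.
  have hres : ∀ t : Fin T, x ((t : ℕ) + 1) (i, s) -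
      rowCoeff Ghat (betaTheta Th) s i ⬝ᵥ x (t : ℕ) = ε ((t : ℕ) + 1) (i, s) +
        ∑ b : Fin m × Fin p, (G i b.1 - Ghat i b.1) * Th i b.1 s b.2 * x (t : ℕ) b := by
    intro t
    rw [hrec, add_sub_cancel_right, Pi.add_apply]
    simp only [Matrix.mulVec, dotProduct, transition, Matrix.of_apply, rowCoeff, betaTheta_apply]
    rw [add_comm, add_sub_assoc, ← Finset.sum_sub_distrib]
    congr 1
    exact Finset.sum_congr rfl fun b _ => by ring
  have hform : crossMoment T x Ghat (s, i, j, s') -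
      (gram T x Ghat *ᵥ betaTheta Th) (s, i, j, s') =
      Ghat i j * ((T : ℝ)⁻¹ * ∑ t : Fin T, x (t : ℕ) a * ε ((t : ℕ) + 1) (i, s) +
        ∑ b : Fin m × Fin p, (G i b.1 - Ghat i b.1) * (Th i b.1 s b.2 *
          ((T : ℝ)⁻¹ * ∑ t : Fin T, x (t : ℕ) a * x (t : ℕ) b))) := by
    rw [crossMoment_apply, gram_mulVec, ← mul_sub, ← Pi.sub_apply, ← Matrix.mulVec_sub,
      design_transpose_mulVec, mul_left_comm]
    congr 1
    have : ∀ t : Fin T, (fun a => response T x a s) (i, t) -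
        (design T x Ghat *ᵥ fun b => betaTheta Th (s, b)) (i, t) = ε ((t : ℕ) + 1) (i, s) +
        ∑ b : Fin m × Fin p, (G i b.1 - Ghat i b.1) * Th i b.1 s b.2 * x (t : ℕ) b := by
      intro t
      rw [design_mulVec, ← hres]
      rfl
    simp only [Pi.sub_apply, this, mul_add, Finset.sum_add_distrib, Finset.mul_sum]
    congr 1
    rw [Finset.sum_comm]
    exact Finset.sum_congr rfl fun b _ => Finset.sum_congr rfl fun t _ => by ring
  rw [hform, abs_mul]
  refine mul_le_mul hub ?_ (abs_nonneg _) (by positivity)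
  refine (abs_add_le _ _).trans (add_le_add (hδ _ _) ?_)
  have hK0 : 0 ≤ K := (abs_nonneg _).trans (hcov a)
  calc |∑ b : Fin m × Fin p, (G i b.1 - Ghat i b.1) * (Th i b.1 s b.2 *
          ((T : ℝ)⁻¹ * ∑ t : Fin T, x (t : ℕ) a * x (t : ℕ) b))|
      ≤ ∑ b : Fin m × Fin p, ν * (|Th i b.1 s b.2| * K) := by
        refine (Finset.abs_sum_le_sum_abs _ _).trans (Finset.sum_le_sum fun b _ => ?_)
        rw [abs_mul, abs_mul]
        refine mul_le_mul ?_ (mul_le_mul_of_nonneg_left (hcov b) (abs_nonneg _)) (by positivity) hν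
        rw [abs_sub_comm]; exact hclose _ _
    _ = ν * ((∑ b : Fin m × Fin p, |Th i b.1 s b.2|) * K) := by
        rw [← Finset.mul_sum, ← Finset.sum_mul]
    _ ≤ _ := mul_le_mul_of_nonneg_left
        (mul_le_mul_of_nonneg_right (h.sum_abs_row_le i s) hK0) hν

end Transfer

/-! ### Toeplitz forms and their symbols -/

section Toeplitz

open Real

lemma integral_cos_int_mul (n : ℤ) :
    ∫ θ in (-π)..π, cos (n * θ) = if n = 0 then 2 * π else 0 := by
  split_ifs with h
  · simp [h]; ring
  · have hn : (n : ℝ) ≠ 0 := by exact_mod_cast h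
    rw [intervalIntegral.integral_comp_mul_left (fun x => cos x) hn, integral_cos]
    simp [sin_int_mul_pi]

lemma integral_cos_mul_cos_int (l n : ℤ) :
    ∫ θ in (-π)..π, cos (l * θ) * cos (n * θ) =
      (if l = n then π else 0) + (if l = -n then π else 0) := by
  have h : ∀ θ : ℝ, cos (l * θ) * cos (n * θ) =
      2⁻¹ * (cos ((l - n : ℤ) * θ) + cos ((l + n : ℤ) * θ)) := by
    intro θ
    push_cast
    rw [sub_mul, add_mul, cos_sub, cos_add]
    ring
  simp only [h]
  rw [intervalIntegral.integral_const_mul, intervalIntegral.integral_add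
    (Continuous.intervalIntegrable (by fun_prop) _ _)
    (Continuous.intervalIntegrable (by fun_prop) _ _), integral_cos_int_mul, integral_cos_int_mul]
  simp only [sub_eq_zero, add_eq_zero_iff_eq_neg]
  split_ifs <;> ring

lemma continuous_cosineSeries {r : ℤ → ℝ} (hr : Summable r) :
    Continuous fun θ : ℝ => ∑' l : ℤ, r l * cos (l * θ) := by
  refine continuous_tsum (fun l => by fun_prop) hr.abs fun l θ => ?_
  rw [norm_mul, norm_eq_abs, norm_eq_abs]
  exact mul_le_of_le_one_right (abs_nonneg _) (abs_cos_le_one _)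

/-- No symmetry of `r` is assumed, so a cosine coefficient sees only the symmetrized sequence. That
suffices, since the quadratic form in `toeplitz_lower` also depends only on it. -/
lemma integral_cosineSeries_mul_cos {r : ℤ → ℝ} (hr : Summable r) (n : ℤ) :
    ∫ θ in (-π)..π, (∑' l : ℤ, r l * cos (l * θ)) * cos (n * θ) = π * (r n + r (-n)) := by
  have h1 := intervalIntegral.hasSum_intervalIntegral_of_summable_norm (a := -π) (b := π)
    (f := fun l : ℤ => (⟨fun θ => r l * cos (l * θ) * cos (n * θ), by fun_prop⟩ : C(ℝ, ℝ))) ?_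
  · have h2 : ∫ θ in (-π)..π, (∑' l : ℤ, r l * cos (l * θ)) * cos (n * θ) =
        ∑' l : ℤ, ((if l = n then r l * π else 0) + (if l = -n then r l * π else 0)) := by
      simp only [← tsum_mul_right]
      refine h1.tsum_eq.symm.trans (tsum_congr fun l => ?_)
      simp only [ContinuousMap.coe_mk, mul_assoc]
      rw [intervalIntegral.integral_const_mul, integral_cos_mul_cos_int]
      split_ifs <;> ring
    rw [h2, Summable.tsum_add, tsum_ite_eq, tsum_ite_eq]
    · ring
    · exact (hasSum_ite_eq n (r n * π)).summable.congr fun l => by split_ifs with h <;> simp [h]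
    · exact (hasSum_ite_eq (-n) (r (-n) * π)).summable.congr fun l => by
        split_ifs with h <;> simp [h]
  · refine Summable.of_nonneg_of_le (fun _ => norm_nonneg _) (fun l => ?_) hr.abs
    refine (ContinuousMap.norm_le _ (abs_nonneg _)).2 fun θ => ?_
    simp only [ContinuousMap.restrict_apply, ContinuousMap.coe_mk, norm_mul, norm_eq_abs]
    have := abs_cos_le_one (l * (θ : ℝ))
    have := abs_cos_le_one (n * (θ : ℝ))
    exact mul_le_of_le_one_right (by positivity) this |>.trans
      (mul_le_of_le_one_right (by positivity) (abs_cos_le_one _))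

/-- A lower bound on the symbol of a Toeplitz form is a lower bound on the form. -/
theorem toeplitz_lower {r : ℤ → ℝ} (hr : Summable r) {b : ℝ}
    (hb : ∀ θ ∈ Set.Icc (-π) π, b ≤ ∑' l : ℤ, r l * cos (l * θ)) {κ : Type*} [Fintype κ]
    {τ : κ → ℤ} (hτ : Function.Injective τ) (c : κ → ℝ) :
    b * ∑ t, c t ^ 2 ≤ ∑ t, ∑ t', c t * c t' * r (τ t' - τ t) := by
  classical
  set F : ℝ → ℝ := fun θ => ∑' l : ℤ, r l * cos (l * θ) with hF
  have hFc : Continuous F := continuous_cosineSeries hr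
  -- This is the squared modulus of the trigonometric polynomial with coefficients `c t` and
  -- frequencies `τ t`. Integrating it against the nonnegative function `F - b` gives the claim;
  -- injectivity of `τ` leaves only the diagonal in the term with `b`.
  set Q : ℝ → ℝ := fun θ => (∑ t, c t * cos (τ t * θ)) ^ 2 + (∑ t, c t * sin (τ t * θ)) ^ 2 with hQ
  have hQe : ∀ θ, Q θ = ∑ t, ∑ t', c t * c t' * cos ((τ t' - τ t : ℤ) * θ) := by
    intro θ
    simp only [hQ, sq, Finset.sum_mul_sum, ← Finset.sum_add_distrib]
    refine Finset.sum_congr rfl fun t _ => Finset.sum_congr rfl fun t' _ => ?_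
    push_cast
    rw [sub_mul, cos_sub]
    ring
  have h0 : 0 ≤ ∫ θ in (-π)..π, (F θ - b) * Q θ := by
    refine intervalIntegral.integral_nonneg (by linarith [pi_pos]) fun θ hθ => ?_
    exact mul_nonneg (sub_nonneg.2 (hb θ hθ)) (by positivity)
  have h1 : ∫ θ in (-π)..π, (F θ - b) * Q θ = ∑ t, ∑ t', c t * c t' *
      (π * (r (τ t' - τ t) + r (-(τ t' - τ t))) - b * if τ t' - τ t = 0 then 2 * π else 0) := by
    have e : ∀ θ, (F θ - b) * Q θ = ∑ t, ∑ t', c t * c t' *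
        (F θ * cos ((τ t' - τ t : ℤ) * θ) - b * cos ((τ t' - τ t : ℤ) * θ)) := by
      intro θ
      rw [hQe, Finset.mul_sum]
      refine Finset.sum_congr rfl fun t _ => ?_
      rw [Finset.mul_sum]
      exact Finset.sum_congr rfl fun t' _ => by ring
    simp only [e]
    rw [intervalIntegral.integral_finsetSum fun t _ =>
      Continuous.intervalIntegrable (by fun_prop) _ _]
    refine Finset.sum_congr rfl fun t _ => ?_
    rw [intervalIntegral.integral_finsetSum fun t _ =>
      Continuous.intervalIntegrable (by fun_prop) _ _]
    refine Finset.sum_congr rfl fun t' _ => ?_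
    rw [intervalIntegral.integral_const_mul, intervalIntegral.integral_sub
      (Continuous.intervalIntegrable (by fun_prop) _ _)
      (Continuous.intervalIntegrable (by fun_prop) _ _), intervalIntegral.integral_const_mul,
      integral_cos_int_mul, integral_cosineSeries_mul_cos hr]
  have h2 : ∑ t, ∑ t', c t * c t' * r (-(τ t' - τ t)) = ∑ t, ∑ t', c t * c t' * r (τ t' - τ t) := by
    rw [Finset.sum_comm]
    refine Finset.sum_congr rfl fun t _ => Finset.sum_congr rfl fun t' _ => ?_
    rw [neg_sub, mul_comm (c t')]
  have h3 : ∑ t, ∑ t', c t * c t' * (b * if τ t' - τ t = 0 then 2 * π else 0) =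
      2 * π * (b * ∑ t, c t ^ 2) := by
    rw [Finset.mul_sum, Finset.mul_sum]
    refine Finset.sum_congr rfl fun t _ => ?_
    rw [Finset.sum_eq_single t]
    · simp only [sub_self, if_true]; ring
    · intro t' _ ht
      rw [if_neg fun h => ht (hτ (sub_eq_zero.1 h))]
      ring
    · simp
  rw [h1] at h0
  simp only [mul_sub, Finset.sum_sub_distrib] at h0
  rw [h3] at h0
  have h4 : ∑ t, ∑ t', c t * c t' * (π * (r (τ t' - τ t) + r (-(τ t' - τ t)))) =
      2 * π * ∑ t, ∑ t', c t * c t' * r (τ t' - τ t) := by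
    have : ∑ t, ∑ t', c t * c t' * (π * (r (τ t' - τ t) + r (-(τ t' - τ t)))) =
        π * (∑ t, ∑ t', c t * c t' * r (τ t' - τ t)) +
        π * ∑ t, ∑ t', c t * c t' * r (-(τ t' - τ t)) := by
      simp only [Finset.mul_sum, ← Finset.sum_add_distrib]
      exact Finset.sum_congr rfl fun t _ => Finset.sum_congr rfl fun t' _ => by ring
    rw [this, h2]
    ring
  rw [h4, sub_nonneg] at h0
  exact le_of_mul_le_mul_left h0 (by positivity)

theorem toeplitz_upper {r : ℤ → ℝ} (hr : Summable r) {b : ℝ}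
    (hb : ∀ θ ∈ Set.Icc (-π) π, ∑' l : ℤ, r l * cos (l * θ) ≤ b) {κ : Type*} [Fintype κ]
    {τ : κ → ℤ} (hτ : Function.Injective τ) (c : κ → ℝ) :
    ∑ t, ∑ t', c t * c t' * r (τ t' - τ t) ≤ b * ∑ t, c t ^ 2 := by
  have := toeplitz_lower hr.neg (b := -b) (fun θ hθ => by
    simp only [neg_mul, tsum_neg]
    exact neg_le_neg (hb θ hθ)) hτ c
  simp only [mul_neg, neg_mul, Finset.sum_neg_distrib] at this
  exact neg_le_neg_iff.1 this

end Toeplitz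

/-! ### Consequences of the bounds on the spectral density -/

section Spectral

variable {m p : ℕ} {Ω : Type*} [MeasurableSpace Ω] {P : Measure Ω}
  {B : Matrix (Fin m × Fin p) (Fin m × Fin p) ℝ} {X : ℤ → Ω → (Fin m × Fin p → ℝ)} {lo hi : ℝ}

/-- The real part of the Hermitian form of a complex matrix at a real vector. -/
def reForm {κ : Type*} [Fintype κ] (v : κ → ℝ) : Matrix κ κ ℂ →+ ℝ :=
  AddMonoidHom.mk' (fun A => ((fun k => (v k : ℂ)) ⬝ᵥ (A *ᵥ fun k => (v k : ℂ))).re) fun A A' => by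
    rw [Matrix.add_mulVec, dotProduct_add, Complex.add_re]

lemma reForm_apply {κ : Type*} [Fintype κ] (v : κ → ℝ) (A : Matrix κ κ ℂ) :
    reForm v A = ((fun k => (v k : ℂ)) ⬝ᵥ (A *ᵥ fun k => (v k : ℂ))).re := rfl

lemma continuous_reForm {κ : Type*} [Fintype κ] (v : κ → ℝ) : Continuous (reForm v) := by
  have : (reForm v : Matrix κ κ ℂ → ℝ) = fun A : Matrix κ κ ℂ =>
      ((fun k => (v k : ℂ)) ⬝ᵥ (A *ᵥ fun k => (v k : ℂ))).re := rfl
  rw [this]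
  fun_prop

lemma reForm_nonneg {κ : Type*} [Fintype κ] (v : κ → ℝ) {A : Matrix κ κ ℂ} (hA : A.PosSemidef) :
    0 ≤ reForm v A := by
  have h := hA.dotProduct_mulVec_nonneg fun k => (v k : ℂ)
  have e : star (fun k => (v k : ℂ)) = fun k => (v k : ℂ) := by
    ext k; simp
  rw [e] at h
  exact (Complex.le_def.1 h).1

lemma reForm_smul_map {κ : Type*} [Fintype κ] (v : κ → ℝ) (z : ℂ) (A : Matrix κ κ ℝ) :
    reForm v (z • A.map fun x : ℝ => (x : ℂ)) = z.re * (v ⬝ᵥ (A *ᵥ v)) := by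
  have e : (fun k => (v k : ℂ)) ⬝ᵥ ((A.map fun x : ℝ => (x : ℂ)) *ᵥ fun k => (v k : ℂ)) =
      ((v ⬝ᵥ (A *ᵥ v) : ℝ) : ℂ) := by
    simp only [dotProduct, Matrix.mulVec, Matrix.map_apply]
    push_cast
    rfl
  rw [reForm_apply, Matrix.smul_mulVec, dotProduct_smul, e, smul_eq_mul, Complex.re_mul_ofReal]

lemma reForm_smul_one {κ : Type*} [Fintype κ] [DecidableEq κ] (v : κ → ℝ) (b : ℝ) :
    reForm v ((b : ℂ) • (1 : Matrix κ κ ℂ)) = b * ∑ k, v k ^ 2 := by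
  have := reForm_smul_map v b (1 : Matrix κ κ ℝ)
  rw [Matrix.map_one _ Complex.ofReal_zero Complex.ofReal_one, Matrix.one_mulVec,
    Complex.ofReal_re] at this
  rw [this]
  simp only [dotProduct, sq]

/-- A divergent series has `tsum` equal to zero, and a zero spectral density contradicts the lower
bound `lo > 0`. The coordinate `a` is there to make the index set nonempty. -/
lemma Stable.summable_series (h : Stable P B X lo hi) (hlo : 0 < lo)
    (a : Fin m × Fin p) {θ : ℝ} (hθ : θ ∈ Set.Icc (-Real.pi) Real.pi) :
    Summable fun l : ℤ => Complex.exp (-(Complex.I * (l : ℂ) * (θ : ℂ))) •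
      (autocov P X l).map (fun x : ℝ => (x : ℂ)) := by
  by_contra hs
  have h1 := reForm_nonneg (Pi.single a 1) (h.lower θ hθ)
  rw [spectralDensity, tsum_eq_zero_of_not_summable hs, smul_zero, map_sub, map_zero,
    reForm_smul_one] at h1
  have : ∑ k, (Pi.single a (1 : ℝ) : Fin m × Fin p → ℝ) k ^ 2 = 1 := by
    simp [Pi.single_apply]
  rw [this] at h1
  linarith

/-- The autocovariance function of the scalar process `v ⬝ᵥ X_t`. -/
def scalarAutocov (P : Measure Ω) (X : ℤ → Ω → (Fin m × Fin p → ℝ)) (v : Fin m × Fin p → ℝ)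
    (l : ℤ) : ℝ :=
  v ⬝ᵥ (autocov P X l *ᵥ v)

lemma exp_neg_I_re (l : ℤ) (θ : ℝ) :
    (Complex.exp (-(Complex.I * (l : ℂ) * (θ : ℂ)))).re = Real.cos (l * θ) := by
  have : -(Complex.I * (l : ℂ) * (θ : ℂ)) = ((-(l * θ) : ℝ) : ℂ) * Complex.I := by
    push_cast; ring
  rw [this, Complex.exp_ofReal_mul_I_re, Real.cos_neg]

lemma Stable.hasSum_scalarAutocov (h : Stable P B X lo hi) (hlo : 0 < lo)
    (a : Fin m × Fin p) {θ : ℝ} (hθ : θ ∈ Set.Icc (-Real.pi) Real.pi) (v : Fin m × Fin p → ℝ) :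
    HasSum (fun l : ℤ => scalarAutocov P X v l * Real.cos (l * θ))
      (2 * Real.pi * reForm v (spectralDensity P X θ)) := by
  have h1 := (h.summable_series hlo a hθ).hasSum.map (reForm v) (continuous_reForm v)
  have h2 : reForm v (spectralDensity P X θ) = (2 * Real.pi)⁻¹ *
      reForm v (∑' l : ℤ, Complex.exp (-(Complex.I * (l : ℂ) * (θ : ℂ))) •
        (autocov P X l).map (fun x : ℝ => (x : ℂ))) := by
    rw [spectralDensity, reForm_apply, reForm_apply, Matrix.smul_mulVec, dotProduct_smul]
    have : (1 / (2 * (Real.pi : ℂ))) = (((2 * Real.pi)⁻¹ : ℝ) : ℂ) := by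
      push_cast; rw [one_div]
    rw [this, smul_eq_mul, Complex.re_ofReal_mul]
  rw [h2, mul_inv_cancel_left₀ (by positivity)]
  refine h1.congr_fun ?_
  intro l
  simp only [Function.comp, reForm_smul_map, exp_neg_I_re, scalarAutocov]
  ring

lemma Stable.summable_scalarAutocov (h : Stable P B X lo hi) (hlo : 0 < lo)
    (a : Fin m × Fin p) (v : Fin m × Fin p → ℝ) : Summable (scalarAutocov P X v) := by
  have := (h.hasSum_scalarAutocov hlo a (θ := 0)
    ⟨by linarith [Real.pi_pos], Real.pi_pos.le⟩ v).summable
  simpa using this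

lemma Stable.toeplitz_bounds (h : Stable P B X lo hi) (hlo : 0 < lo)
    (a : Fin m × Fin p) (v : Fin m × Fin p → ℝ) {κ : Type*} [Fintype κ]
    {τ : κ → ℤ} (hτ : Function.Injective τ) (c : κ → ℝ) :
    2 * Real.pi * lo * (∑ b, v b ^ 2) * ∑ t, c t ^ 2 ≤
        ∑ t, ∑ t', c t * c t' * scalarAutocov P X v (τ t' - τ t) ∧
      ∑ t, ∑ t', c t * c t' * scalarAutocov P X v (τ t' - τ t) ≤
        2 * Real.pi * hi * (∑ b, v b ^ 2) * ∑ t, c t ^ 2 := by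
  have hs := h.summable_scalarAutocov hlo a v
  refine ⟨toeplitz_lower hs (fun θ hθ => ?_) hτ c, toeplitz_upper hs (fun θ hθ => ?_) hτ c⟩
  · have h1 := reForm_nonneg v (h.lower θ hθ)
    rw [map_sub, reForm_smul_one] at h1
    rw [(h.hasSum_scalarAutocov hlo a hθ v).tsum_eq]
    have := mul_le_mul_of_nonneg_left (sub_nonneg.1 h1) Real.two_pi_pos.le
    linarith
  · have h1 := reForm_nonneg v (h.upper θ hθ)
    rw [map_sub, reForm_smul_one] at h1
    rw [(h.hasSum_scalarAutocov hlo a hθ v).tsum_eq]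
    have := mul_le_mul_of_nonneg_left (sub_nonneg.1 h1) Real.two_pi_pos.le
    linarith

lemma Stable.autocov_tendsto_zero (h : Stable P B X lo hi) (hlo : 0 < lo) (a b : Fin m × Fin p) :
    Filter.Tendsto (fun n : ℕ => autocov P X n a b) Filter.atTop (nhds 0) := by
  have h1 := (h.summable_series hlo a (θ := 0)
    ⟨by linarith [Real.pi_pos], Real.pi_pos.le⟩).tendsto_cofinite_zero
  have h2 := (h1.comp (Nat.cast_injective (R := ℤ)).tendsto_cofinite)
  rw [Nat.cofinite_eq_atTop] at h2
  have h3 : Continuous fun A : Matrix (Fin m × Fin p) (Fin m × Fin p) ℂ => (A a b).re := by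
    fun_prop
  have h4 := (h3.tendsto 0).comp h2
  simpa [Function.comp_def] using h4

end Spectral

/-! ### A stationary solution with bounded spectrum is a centred Gaussian process -/

section Gaussian

open Filter Topology

variable {m p : ℕ} {Ω : Type*} [MeasurableSpace Ω] {P : Measure Ω}
  {B : Matrix (Fin m × Fin p) (Fin m × Fin p) ℝ} {σ : ℝ}
  {X ε : ℤ → Ω → (Fin m × Fin p → ℝ)} {lo hi : ℝ}

@[fun_prop]
lemma measurable_dotProduct_const {κ : Type*} [Fintype κ] {α : Type*} [MeasurableSpace α]
    (ξ : κ → ℝ) {f : α → κ → ℝ} (hf : Measurable f) : Measurable fun ω => ξ ⬝ᵥ f ω := by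
  simp only [dotProduct]
  fun_prop

namespace IsStationaryVAR

lemma measurable_apply (h : IsStationaryVAR P B σ X ε) (t : ℤ) (a : Fin m × Fin p) :
    Measurable fun ω => X t ω a := (measurable_pi_apply a).comp (h.measurable_X t)

lemma measurable_path (h : IsStationaryVAR P B σ X ε) (s : ℤ) :
    Measurable fun ω t => X (t + s) ω := measurable_pi_iff.2 fun t => h.measurable_X (t + s)

lemma indep_functional (h : IsStationaryVAR P B σ X ε) (t : ℤ) {β γ : Type*} [MeasurableSpace β]
    [MeasurableSpace γ] {f : (Fin m × Fin p → ℝ) → β} (hf : Measurable f)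
    {F : ((Set.Iio t) → (Fin m × Fin p → ℝ)) → γ} (hF : Measurable F) :
    IndepFun (fun ω => F fun u => X u ω) (fun ω => f (ε t ω)) P :=
  ((h.indep_past t).comp hf hF).symm

lemma hasGaussianLaw_noise (h : IsStationaryVAR P B σ X ε) (t : ℤ) (ξ : Fin m × Fin p → ℝ) :
    HasGaussianLaw (fun ω => ξ ⬝ᵥ ε t ω) P := by
  have := h.gaussian t
  have h1 : HasGaussianLaw (ε t) P := ⟨this⟩
  have h2 := h1.map_fun (∑ a, ξ a • ContinuousLinearMap.proj (R := ℝ) a)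
  simpa [dotProduct] using h2

lemma dotProduct_recursion (h : IsStationaryVAR P B σ X ε) (t : ℤ) (ξ : Fin m × Fin p → ℝ)
    (ω : Ω) : ξ ⬝ᵥ X t ω = (Bᵀ *ᵥ ξ) ⬝ᵥ X (t - 1) ω + ξ ⬝ᵥ ε t ω := by
  rw [h.recursion t ω, dotProduct_add, Matrix.dotProduct_mulVec, Matrix.mulVec_transpose]

lemma indep_step (h : IsStationaryVAR P B σ X ε) (t : ℤ) (ξ ζ : Fin m × Fin p → ℝ) :
    IndepFun (fun ω => ζ ⬝ᵥ X (t - 1) ω) (fun ω => ξ ⬝ᵥ ε t ω) P :=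
  h.indep_functional t (f := fun y => ξ ⬝ᵥ y) (by fun_prop)
    (F := fun y => ζ ⬝ᵥ y ⟨t - 1, by simp⟩) (by fun_prop)

lemma scalarAutocov_single (a : Fin m × Fin p) (l : ℤ) :
    scalarAutocov P X (Pi.single a 1) l = autocov P X l a a := by
  simp [scalarAutocov]

lemma isUnit_autocov_zero (hst : Stable P B X lo hi) (hlo : 0 < lo) :
    IsUnit (autocov P X 0) := by
  rw [← Matrix.mulVec_injective_iff_isUnit]
  refine (injective_iff_map_eq_zero (Matrix.mulVecLin (autocov P X 0))).2 fun v hv => ?_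
  ext a
  -- A single time point with coefficient one: the Toeplitz bound becomes a lower bound on the form
  -- of the covariance of `X_0`.
  have h1 := (hst.toeplitz_bounds hlo a v (κ := Unit) (τ := fun _ => 0)
    (Function.injective_of_subsingleton _) 1).1
  rw [Matrix.mulVecLin_apply] at hv
  simp only [Finset.univ_unique, Pi.one_apply, Finset.sum_const, Finset.card_singleton,
    sub_self, scalarAutocov, one_smul, mul_one, one_pow, one_mul, hv, dotProduct_zero] at h1
  have h2 : ∑ b, v b ^ 2 ≤ 0 := nonpos_of_mul_nonpos_right h1 (by positivity)
  have h3 := (Finset.single_le_sum (f := fun b => v b ^ 2) (fun _ _ => sq_nonneg _)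
    (Finset.mem_univ a)).trans h2
  exact pow_eq_zero_iff two_ne_zero |>.1 (le_antisymm h3 (sq_nonneg _))

lemma map_eq (h : IsStationaryVAR P B σ X ε) (t : ℤ) : P.map (X t) = P.map (X 0) := by
  have h1 := congrArg (Measure.map fun x : ℤ → (Fin m × Fin p → ℝ) => x 0) (h.stationary t)
  have h0 := h.measurable_path 0
  simp only [add_zero] at h0
  rw [Measure.map_map (measurable_pi_apply 0) (h.measurable_path t),
    Measure.map_map (measurable_pi_apply 0) h0] at h1
  simpa [Function.comp_def] using h1

lemma covariance_shift (h : IsStationaryVAR P B σ X ε) (s t : ℤ) (a b : Fin m × Fin p) :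
    ProbabilityTheory.covariance (fun ω => X s ω a) (fun ω => X t ω b) P =
      autocov P X (t - s) a b := by
  have m1 : ∀ (u : ℤ) (c : Fin m × Fin p),
      Measurable fun x : ℤ → (Fin m × Fin p → ℝ) => x u c := fun u c =>
    (measurable_pi_apply c).comp (measurable_pi_apply u)
  have e := fun u => covariance_map_fun (μ := P) (Z := fun ω t => X (t + u) ω)
    (m1 0 a).aestronglyMeasurable (m1 (t - s) b).aestronglyMeasurable
    (h.measurable_path u).aemeasurable
  have e1 := e s
  have e2 := e 0
  simp only [add_zero] at e2
  rw [h.stationary s, e2] at e1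
  simpa [autocov] using e1.symm

lemma memLp_noise (h : IsStationaryVAR P B σ X ε) (t : ℤ) (ξ : Fin m × Fin p → ℝ) :
    MemLp (fun ω => ξ ⬝ᵥ ε t ω) 2 P := (h.hasGaussianLaw_noise t ξ).memLp_two

lemma memLp_noise_apply (h : IsStationaryVAR P B σ X ε) (t : ℤ) (a : Fin m × Fin p) :
    MemLp (fun ω => ε t ω a) 2 P := by
  simpa using h.memLp_noise t (Pi.single a 1)

/-- The characteristic function of `X_0`. -/
def marginalCharFun (P : Measure Ω) (X : ℤ → Ω → (Fin m × Fin p → ℝ)) (ξ : Fin m × Fin p → ℝ) :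
    ℂ := ∫ ω, Complex.exp ((ξ ⬝ᵥ X 0 ω : ℝ) * Complex.I) ∂P

lemma charFun_map_dotProduct (h : IsStationaryVAR P B σ X ε) (t : ℤ) (ξ : Fin m × Fin p → ℝ)
    (s : ℝ) : charFun (P.map fun ω => ξ ⬝ᵥ X t ω) s = marginalCharFun P X (s • ξ) := by
  have e : P.map (fun ω => ξ ⬝ᵥ X t ω) = P.map fun ω => ξ ⬝ᵥ X 0 ω := by
    have e1 := fun t => Measure.map_map (μ := P) (f := X t)
      (g := fun y : Fin m × Fin p → ℝ => ξ ⬝ᵥ y) (by fun_prop) (h.measurable_X t)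
    have := congrArg (Measure.map fun y : Fin m × Fin p → ℝ => ξ ⬝ᵥ y) (h.map_eq t)
    rw [e1, e1] at this
    exact this
  have := h.measurable_X 0
  rw [e, charFun_apply_real, integral_map (by fun_prop) (by fun_prop), marginalCharFun]
  refine integral_congr_ae (Eventually.of_forall fun ω => ?_)
  simp only [smul_dotProduct, smul_eq_mul]
  push_cast
  rfl

variable [IsProbabilityMeasure P]

lemma map_noise (h : IsStationaryVAR P B σ X ε) (t : ℤ) (ξ : Fin m × Fin p → ℝ) :
    P.map (fun ω => ξ ⬝ᵥ ε t ω) =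
      gaussianReal 0 (Var[fun ω => ξ ⬝ᵥ ε t ω; P]).toNNReal := by
  rw [(h.hasGaussianLaw_noise t ξ).map_eq_gaussianReal]
  congr 1
  simp only [dotProduct]
  rw [integral_finsetSum _ fun a _ =>
    ((h.memLp_noise_apply t a).integrable one_le_two).const_mul (ξ a)]
  exact Finset.sum_eq_zero fun a _ => by rw [integral_const_mul, h.centred, mul_zero]

/-- Square integrability is forced: otherwise the Bochner integral defining the variance would be
zero, against the spectral lower bound. This holds whatever the value of the centring `c`, so
integrability of `X 0` is not needed beforehand. -/
lemma memLp_zero (h : IsStationaryVAR P B σ X ε) (hst : Stable P B X lo hi) (hlo : 0 < lo)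
    (a : Fin m × Fin p) : MemLp (fun ω => X 0 ω a) 2 P := by
  have h1 := (hst.toeplitz_bounds hlo a (Pi.single a 1) (κ := Unit) (τ := fun _ => 0)
    (Function.injective_of_subsingleton _) 1).1
  have hsum : ∑ k, (Pi.single a (1 : ℝ) : Fin m × Fin p → ℝ) k ^ 2 = 1 := by
    simp [Pi.single_apply]
  simp only [hsum, Finset.univ_unique, Pi.one_apply, Finset.sum_const, Finset.card_singleton,
    sub_self, scalarAutocov_single, one_smul, mul_one, one_pow, one_mul] at h1
  have h2 : 0 < autocov P X 0 a a := lt_of_lt_of_le (by positivity) h1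
  set c := ∫ ω, X 0 ω a ∂P with hc
  have h3 : Integrable (fun ω => (X 0 ω a - c) ^ 2) P := by
    by_contra hni
    have : autocov P X 0 a a = ∫ ω, (X 0 ω a - c) ^ 2 ∂P := by
      simp only [autocov, Matrix.of_apply, ProbabilityTheory.covariance, sq, hc]
    rw [this, integral_undef hni] at h2
    exact lt_irrefl _ h2
  have h4 := (memLp_two_iff_integrable_sq
    ((h.measurable_apply 0 a).sub_const c).aestronglyMeasurable).2 h3
  have h5 := h4.add (memLp_const c)
  convert h5 using 1
  ext ω
  simp

lemma memLp_apply (h : IsStationaryVAR P B σ X ε) (hst : Stable P B X lo hi) (hlo : 0 < lo)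
    (t : ℤ) (a : Fin m × Fin p) : MemLp (fun ω => X t ω a) 2 P := by
  have h1 := h.memLp_zero hst hlo a
  have e := fun t => memLp_map_measure_iff (p := 2) (μ := P) (f := X t)
    (g := fun y : Fin m × Fin p → ℝ => y a) (measurable_pi_apply a).aestronglyMeasurable
    (h.measurable_X t).aemeasurable
  exact (e t).1 (by rw [h.map_eq t]; exact (e 0).2 h1)

lemma memLp_dotProduct (h : IsStationaryVAR P B σ X ε) (hst : Stable P B X lo hi) (hlo : 0 < lo)
    (t : ℤ) (ξ : Fin m × Fin p → ℝ) : MemLp (fun ω => ξ ⬝ᵥ X t ω) 2 P := by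
  simp only [dotProduct]
  exact memLp_finsetSum _ fun a _ => (h.memLp_apply hst hlo t a).const_mul (ξ a)

lemma covariance_dotProduct (h : IsStationaryVAR P B σ X ε) (hst : Stable P B X lo hi)
    (hlo : 0 < lo) (s t : ℤ) (v : Fin m × Fin p → ℝ) :
    ProbabilityTheory.covariance (fun ω => v ⬝ᵥ X s ω) (fun ω => v ⬝ᵥ X t ω) P =
      scalarAutocov P X v (t - s) := by
  simp only [dotProduct]
  rw [covariance_fun_sum_fun_sum (fun a => (h.memLp_apply hst hlo s a).const_mul (v a))
    fun a => (h.memLp_apply hst hlo t a).const_mul (v a)]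
  simp only [covariance_const_mul_left, covariance_const_mul_right, h.covariance_shift,
    scalarAutocov, dotProduct, Matrix.mulVec, Finset.mul_sum]
  exact Finset.sum_congr rfl fun a _ => Finset.sum_congr rfl fun b _ => by ring

lemma autocov_succ (h : IsStationaryVAR P B σ X ε) (hst : Stable P B X lo hi)
    (hlo : 0 < lo) (n : ℕ) : autocov P X ((n + 1 : ℕ) : ℤ) = autocov P X n * Bᵀ := by
  ext a b
  have hind : IndepFun (fun ω => X 0 ω a) (fun ω => ε ((n + 1 : ℕ) : ℤ) ω b) P :=
    h.indep_functional ((n + 1 : ℕ) : ℤ) (f := fun y => y b) (measurable_pi_apply b)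
      (F := fun y => y ⟨0, by simp only [Set.mem_Iio]; positivity⟩ a) (by fun_prop)
  have hX : ∀ ω, X ((n + 1 : ℕ) : ℤ) ω b = (∑ c, B b c * X n ω c) + ε ((n + 1 : ℕ) : ℤ) ω b := by
    intro ω
    rw [h.recursion]
    simp [Matrix.mulVec, dotProduct]
  simp only [autocov, Matrix.of_apply, Matrix.mul_apply, hX, Matrix.transpose_apply]
  have hs : MemLp (fun ω => ∑ c, B b c * X n ω c) 2 P :=
    memLp_finsetSum _ fun c _ => (h.memLp_apply hst hlo n c).const_mul (B b c)
  have e1 := covariance_add_right (h.memLp_apply hst hlo 0 a) hs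
    (h.memLp_noise_apply ((n + 1 : ℕ) : ℤ) b)
  have e2 := hind.covariance_eq_zero (h.memLp_apply hst hlo 0 a)
    (h.memLp_noise_apply ((n + 1 : ℕ) : ℤ) b)
  rw [e2, add_zero, covariance_fun_sum_right
    (fun c => (h.memLp_apply hst hlo n c).const_mul (B b c)) (h.memLp_apply hst hlo 0 a)] at e1
  simp only [covariance_const_mul_right] at e1
  refine Eq.trans e1 (Finset.sum_congr rfl fun c _ => mul_comm _ _)

lemma autocov_nat (h : IsStationaryVAR P B σ X ε) (hst : Stable P B X lo hi)
    (hlo : 0 < lo) (n : ℕ) : autocov P X n = autocov P X 0 * Bᵀ ^ n := by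
  induction n with
  | zero => simp
  | succ n ih => rw [h.autocov_succ hst hlo, ih, pow_succ, Matrix.mul_assoc]

/-- The autocovariances are `autocov P X 0 * Bᵀ ^ n` and tend to zero by summability; the invertible
first factor can be removed. -/
lemma tendsto_pow_mulVec (h : IsStationaryVAR P B σ X ε) (hst : Stable P B X lo hi)
    (hlo : 0 < lo) (ξ : Fin m × Fin p → ℝ) :
    Tendsto (fun n : ℕ => (Bᵀ ^ n) *ᵥ ξ) atTop (𝓝 0) := by
  have h1 : Tendsto (fun n : ℕ => autocov P X (n : ℤ)) atTop (𝓝 0) :=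
    tendsto_pi_nhds.2 fun a => tendsto_pi_nhds.2 fun b => hst.autocov_tendsto_zero hlo a b
  have hc : Continuous fun A : Matrix (Fin m × Fin p) (Fin m × Fin p) ℝ =>
      (autocov P X 0)⁻¹ *ᵥ (A *ᵥ ξ) := by fun_prop
  have h2 := (hc.tendsto 0).comp h1
  simp only [Matrix.zero_mulVec, Matrix.mulVec_zero] at h2
  refine h2.congr fun n => ?_
  simp only [Function.comp]
  rw [h.autocov_nat hst hlo, Matrix.mulVec_mulVec, ← Matrix.mul_assoc,
    Matrix.nonsing_inv_mul _ ((Matrix.isUnit_iff_isUnit_det _).1 (isUnit_autocov_zero hst hlo)),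
    Matrix.one_mul]

lemma variance_dotProduct (h : IsStationaryVAR P B σ X ε) (hst : Stable P B X lo hi)
    (hlo : 0 < lo) (t : ℤ) (ξ : Fin m × Fin p → ℝ) :
    Var[fun ω => ξ ⬝ᵥ X t ω; P] = scalarAutocov P X ξ 0 := by
  rw [← covariance_self (h.memLp_dotProduct hst hlo t ξ).aemeasurable,
    h.covariance_dotProduct hst hlo, sub_self]

lemma variance_noise (h : IsStationaryVAR P B σ X ε) (hst : Stable P B X lo hi)
    (hlo : 0 < lo) (t : ℤ) (ξ : Fin m × Fin p → ℝ) :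
    Var[fun ω => ξ ⬝ᵥ ε t ω; P] =
      scalarAutocov P X ξ 0 - scalarAutocov P X (Bᵀ *ᵥ ξ) 0 := by
  have h1 := (h.indep_step t ξ (Bᵀ *ᵥ ξ)).variance_fun_add
    (h.memLp_dotProduct hst hlo (t - 1) _) (h.memLp_noise t ξ)
  simp only [← h.dotProduct_recursion] at h1
  rw [h.variance_dotProduct hst hlo, h.variance_dotProduct hst hlo] at h1
  linarith

/-- By independence the characteristic function picks up the factor `exp(-Var(ξ'ε)/2)` in one step,
and this variance is the drop of `scalarAutocov P X · 0` from `ξ` to `Bᵀξ`. Hence the characteristic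
function divided by its Gaussian candidate is invariant under `Bᵀ`. -/
lemma marginalCharFun_step (h : IsStationaryVAR P B σ X ε) (hst : Stable P B X lo hi)
    (hlo : 0 < lo) (ξ : Fin m × Fin p → ℝ) :
    marginalCharFun P X ξ * Complex.exp (scalarAutocov P X ξ 0 / 2) =
      marginalCharFun P X (Bᵀ *ᵥ ξ) *
        Complex.exp (scalarAutocov P X (Bᵀ *ᵥ ξ) 0 / 2) := by
  have hX := h.measurable_X (0 - 1)
  have hε := h.measurable_noise 0
  have h1 := (h.indep_step 0 ξ (Bᵀ *ᵥ ξ)).charFun_map_fun_add_eq_mul (by fun_prop) (by fun_prop)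
  simp only [← h.dotProduct_recursion] at h1
  have h2 := congrFun h1 1
  rw [Pi.mul_apply, h.charFun_map_dotProduct, h.charFun_map_dotProduct, h.map_noise,
    charFun_gaussianReal, one_smul, one_smul,
    Real.coe_toNNReal _ (variance_nonneg _ _), h.variance_noise hst hlo] at h2
  rw [h2, mul_assoc, ← Complex.exp_add]
  congr 2
  push_cast
  ring

/-- The invariant ratio is evaluated along `(Bᵀ)ⁿ ξ → 0`, where it tends to one by continuity. This
gives Gaussianity and mean zero together. -/
lemma marginalCharFun_eq (h : IsStationaryVAR P B σ X ε) (hst : Stable P B X lo hi)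
    (hlo : 0 < lo) (ξ : Fin m × Fin p → ℝ) :
    marginalCharFun P X ξ = Complex.exp (-(scalarAutocov P X ξ 0 / 2)) := by
  have hinv : ∀ n : ℕ, marginalCharFun P X ((Bᵀ ^ n) *ᵥ ξ) *
      Complex.exp (scalarAutocov P X ((Bᵀ ^ n) *ᵥ ξ) 0 / 2) =
      marginalCharFun P X ξ * Complex.exp (scalarAutocov P X ξ 0 / 2) := by
    intro n
    induction n with
    | zero => simp
    | succ n ih =>
      rw [← ih, h.marginalCharFun_step hst hlo ((Bᵀ ^ n) *ᵥ ξ), Matrix.mulVec_mulVec, ← pow_succ']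
  have hlim := h.tendsto_pow_mulVec hst hlo ξ
  have h1 : Tendsto (fun n : ℕ => marginalCharFun P X ((Bᵀ ^ n) *ᵥ ξ)) atTop (𝓝 1) := by
    have : (1 : ℂ) = ∫ ω, Complex.exp (((0 : Fin m × Fin p → ℝ) ⬝ᵥ X 0 ω : ℝ) * Complex.I) ∂P := by
      simp
    rw [this]
    have hX := h.measurable_X 0
    refine tendsto_integral_of_dominated_convergence (fun _ => 1) (fun n => by fun_prop)
      (integrable_const _) (fun n => Eventually.of_forall fun ω => ?_)
      (Eventually.of_forall fun ω => ?_)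
    · rw [Complex.norm_exp_ofReal_mul_I]
    · have hc : Continuous fun ζ : Fin m × Fin p → ℝ =>
          Complex.exp ((ζ ⬝ᵥ X 0 ω : ℝ) * Complex.I) := by fun_prop
      exact (hc.tendsto 0).comp hlim
  have h2 : Tendsto (fun n : ℕ => Complex.exp ((scalarAutocov P X ((Bᵀ ^ n) *ᵥ ξ) 0 : ℝ) / 2))
      atTop (𝓝 1) := by
    have hc : Continuous fun ζ : Fin m × Fin p → ℝ =>
        Complex.exp ((scalarAutocov P X ζ 0 : ℝ) / 2) := by
      unfold scalarAutocov
      fun_prop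
    have := (hc.tendsto 0).comp hlim
    simpa [scalarAutocov, Function.comp_def] using this
  have h3 := h1.mul h2
  simp only [hinv, mul_one] at h3
  have h4 := tendsto_nhds_unique h3 tendsto_const_nhds
  rw [Complex.exp_neg]
  exact eq_inv_of_mul_eq_one_left h4.symm

lemma map_dotProduct (h : IsStationaryVAR P B σ X ε) (hst : Stable P B X lo hi)
    (hlo : 0 < lo) (t : ℤ) (ξ : Fin m × Fin p → ℝ) :
    P.map (fun ω => ξ ⬝ᵥ X t ω) = gaussianReal 0 (scalarAutocov P X ξ 0).toNNReal := by
  have hv : 0 ≤ scalarAutocov P X ξ 0 := by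
    rw [← h.variance_dotProduct hst hlo t]
    exact variance_nonneg _ _
  have hX := h.measurable_X t
  have : IsProbabilityMeasure (P.map fun ω => ξ ⬝ᵥ X t ω) :=
    Measure.isProbabilityMeasure_map (by fun_prop)
  refine Measure.ext_of_charFun (funext fun s => ?_)
  rw [h.charFun_map_dotProduct, h.marginalCharFun_eq hst hlo, charFun_gaussianReal,
    Real.coe_toNNReal _ hv]
  have : scalarAutocov P X (s • ξ) 0 = s ^ 2 * scalarAutocov P X ξ 0 := by
    simp only [scalarAutocov, Matrix.mulVec_smul, smul_dotProduct, dotProduct_smul, smul_eq_mul]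
    ring
  rw [this]
  congr 1
  push_cast
  ring

lemma exists_map_sum (h : IsStationaryVAR P B σ X ε) (hst : Stable P B X lo hi)
    (hlo : 0 < lo) (n : ℕ) (c : ℕ → Fin m × Fin p → ℝ) :
    ∃ s : NNReal, P.map (fun ω => ∑ k ∈ Finset.range (n + 1), c k ⬝ᵥ X (k : ℤ) ω) =
      gaussianReal 0 s := by
  induction n generalizing c with
  | zero => exact ⟨_, by simpa using h.map_dotProduct hst hlo 0 (c 0)⟩
  | succ n ih =>
    -- The last observation is replaced by `B X_n` plus fresh noise: the first part is absorbed into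
    -- the coefficient at time `n`, the second is independent of everything earlier.
    set c' : ℕ → Fin m × Fin p → ℝ := fun k => c k + if k = n then Bᵀ *ᵥ c (n + 1) else 0 with hc'
    obtain ⟨s, hs⟩ := ih c'
    have e : ∀ ω, ∑ k ∈ Finset.range (n + 1 + 1), c k ⬝ᵥ X (k : ℤ) ω =
        ∑ k ∈ Finset.range (n + 1), c' k ⬝ᵥ X (k : ℤ) ω +
          c (n + 1) ⬝ᵥ ε ((n + 1 : ℕ) : ℤ) ω := by
      intro ω
      rw [Finset.sum_range_succ, h.dotProduct_recursion]
      simp only [hc', add_dotProduct, Finset.sum_add_distrib]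
      rw [← add_assoc]
      congr 2
      rw [Finset.sum_eq_single n]
      · simp
      · intro k _ hk
        simp [hk]
      · simp
    have hind : IndepFun (fun ω => ∑ k ∈ Finset.range (n + 1), c' k ⬝ᵥ X (k : ℤ) ω)
        (fun ω => c (n + 1) ⬝ᵥ ε ((n + 1 : ℕ) : ℤ) ω) P := by
      have := h.indep_functional ((n + 1 : ℕ) : ℤ) (f := fun y => c (n + 1) ⬝ᵥ y) (by fun_prop)
        (F := fun y => ∑ k : Fin (n + 1), c' k ⬝ᵥ y ⟨(k : ℕ), by
          have := k.2
          simp only [Set.mem_Iio]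
          exact_mod_cast this⟩) (by fun_prop)
      simpa only [Finset.sum_range] using this
    have := gaussianReal_add_gaussianReal_of_indepFun hind hs (h.map_noise _ _)
    refine ⟨_, Eq.trans ?_ (this.trans (by rw [add_zero]))⟩
    congr 1
    funext ω
    exact e ω

/-- Linear combinations of the scalar process `v ⬝ᵥ X_t` are centred Gaussian with variance
controlled by the spectral bounds. -/
theorem exists_map_combination (h : IsStationaryVAR P B σ X ε) (hst : Stable P B X lo hi)
    (hlo : 0 < lo) (a : Fin m × Fin p) (v : Fin m × Fin p → ℝ) {T : ℕ} (z : Fin T → ℝ) :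
    ∃ s : NNReal, P.map (fun ω => ∑ t : Fin T, z t * (v ⬝ᵥ X (t : ℕ) ω)) = gaussianReal 0 s ∧
      2 * Real.pi * lo * (∑ b, v b ^ 2) * ∑ t, z t ^ 2 ≤ s ∧
      s ≤ 2 * Real.pi * hi * (∑ b, v b ^ 2) * ∑ t, z t ^ 2 := by
  have hlaw : ∃ s : NNReal,
      P.map (fun ω => ∑ t : Fin T, z t * (v ⬝ᵥ X (t : ℕ) ω)) = gaussianReal 0 s := by
    rcases T with _ | n
    · exact ⟨0, by simp [gaussianReal_zero_var]⟩
    · obtain ⟨s, hs⟩ := h.exists_map_sum hst hlo n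
        fun k => (if hk : k < n + 1 then z ⟨k, hk⟩ else 0) • v
      refine ⟨s, hs ▸ ?_⟩
      congr 1
      funext ω
      rw [Finset.sum_range]
      exact Finset.sum_congr rfl fun t _ => by
        rw [dif_pos t.2, smul_dotProduct, smul_eq_mul]
  obtain ⟨s, hs⟩ := hlaw
  have hmem : ∀ t : Fin T, MemLp (fun ω => z t * (v ⬝ᵥ X (t : ℕ) ω)) 2 P := fun t =>
    (h.memLp_dotProduct hst hlo _ v).const_mul (z t)
  have hvar : (s : ℝ) = ∑ t : Fin T, ∑ t' : Fin T,
      z t * z t' * scalarAutocov P X v ((t' : ℕ) - (t : ℕ)) := by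
    have h1 : Var[id; P.map (fun ω => ∑ t : Fin T, z t * (v ⬝ᵥ X (t : ℕ) ω))] = s := by
      rw [hs, variance_id_gaussianReal]
    rw [variance_map aemeasurable_id (memLp_finsetSum _ fun t _ => hmem t).aemeasurable,
      Function.id_comp, variance_fun_sum hmem] at h1
    simp only [covariance_const_mul_left, covariance_const_mul_right,
      h.covariance_dotProduct hst hlo] at h1
    rw [← h1]
    exact Finset.sum_congr rfl fun a _ => Finset.sum_congr rfl fun b _ => by ring
  have hb := hst.toeplitz_bounds hlo a v (τ := fun t : Fin T => ((t : ℕ) : ℤ))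
    (fun t t' htt => Fin.ext (Nat.cast_injective (R := ℤ) htt)) z
  refine ⟨s, hs, ?_, ?_⟩
  · rw [hvar]; exact hb.1
  · rw [hvar]; exact hb.2

end IsStationaryVAR

end Gaussian

/-! ### Tail bounds for Gaussian quadratic forms -/

section Tails

variable {Ω : Type*} [MeasurableSpace Ω] {P : Measure Ω}

lemma measureReal_le_of_lintegral_exp {f : Ω → ℝ} (hf : Measurable f) {M : ℝ} (hM : 0 ≤ M)
    (h : ∫⁻ ω, ENNReal.ofReal (Real.exp (f ω)) ∂P ≤ ENNReal.ofReal M) (r : ℝ) :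
    P.real {ω | r ≤ f ω} ≤ M * Real.exp (-r) := by
  have h1 := (mul_meas_ge_le_lintegral₀ (μ := P) (f := fun ω => ENNReal.ofReal (Real.exp (f ω)))
    (by fun_prop) (ENNReal.ofReal (Real.exp r))).trans h
  simp only [ENNReal.ofReal_le_ofReal_iff (Real.exp_pos _).le, Real.exp_le_exp] at h1
  have h2 : P {ω | r ≤ f ω} ≤ ENNReal.ofReal (M * Real.exp (-r)) := by
    rw [Real.exp_neg, ← div_eq_mul_inv, ENNReal.ofReal_div_of_pos (Real.exp_pos r),
      ENNReal.le_div_iff_mul_le (Or.inl (by simp [Real.exp_pos])) (Or.inl ENNReal.ofReal_ne_top),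
      mul_comm]
    exact h1
  exact ENNReal.toReal_le_of_le_ofReal (by positivity) h2

/-- The root `c` of `1 + 2b` is a parameter, so the two uses, `1 + 2b = 4` and `1 + 2b = 1/4`, give
the rational values `1/2` and `2`. -/
lemma integral_exp_sq_gaussianReal {b c : ℝ} (hc : 0 < c) (hb : 1 + 2 * b = c ^ 2) :
    ∫ z, Real.exp (-b * z ^ 2) ∂gaussianReal 0 1 = c⁻¹ := by
  rw [integral_gaussianReal_eq_integral_smul one_ne_zero]
  have e : ∀ z : ℝ, gaussianPDFReal 0 1 z • Real.exp (-b * z ^ 2) =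
      (√(2 * Real.pi))⁻¹ * Real.exp (-(c ^ 2 / 2) * z ^ 2) := by
    intro z
    simp only [gaussianPDFReal, NNReal.coe_one, mul_one, sub_zero, smul_eq_mul]
    rw [mul_assoc, ← Real.exp_add]
    congr 2
    rw [← hb]
    ring
  simp only [e]
  rw [integral_const_mul, integral_gaussian]
  have : Real.pi / (c ^ 2 / 2) = 2 * Real.pi * (c⁻¹) ^ 2 := by field_simp
  rw [this, Real.sqrt_mul' _ (sq_nonneg _), Real.sqrt_sq (by positivity),
    inv_mul_cancel_left₀ (by positivity)]

lemma integrable_exp_sq_gaussianReal {b c : ℝ} (hc : 0 < c) (hb : 1 + 2 * b = c ^ 2) :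
    Integrable (fun z => Real.exp (-b * z ^ 2)) (gaussianReal 0 1) :=
  Integrable.of_integral_ne_zero (by
    rw [integral_exp_sq_gaussianReal hc hb]
    positivity)

variable {T : ℕ} {Y : Fin T → Ω → ℝ}

/-- The Laplace transform of a Gaussian quadratic form with covariance bounded below. -/
lemma integral_exp_neg_sum_sq_le [IsProbabilityMeasure P] (hY : ∀ t, Measurable (Y t))
    (hlaw : ∀ z : Fin T → ℝ, ∃ s : NNReal, P.map (fun ω => ∑ t, z t * Y t ω) = gaussianReal 0 s ∧
      3 * ∑ t, z t ^ 2 ≤ s) :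
    ∫ ω, Real.exp (-(∑ t, Y t ω ^ 2) / 2) ∂P ≤ (1 / 2) ^ T := by
  set γ : Measure (Fin T → ℝ) := Measure.pi fun _ => gaussianReal 0 1 with hγ
  -- Linearization: the Gaussian of `Y` is the characteristic function of an auxiliary standard
  -- normal `z`. After Fubini only the laws of the linear forms `z'Y` matter, and the dependence
  -- among the `Y t` is harmless.
  have hin : ∀ ω, ∫ z, Complex.exp ((∑ t, z t * Y t ω : ℝ) * Complex.I) ∂γ =
      ((Real.exp (-(∑ t, Y t ω ^ 2) / 2) : ℝ) : ℂ) := by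
    intro ω
    have e : ∀ z : Fin T → ℝ, Complex.exp ((∑ t, z t * Y t ω : ℝ) * Complex.I) =
        ∏ t, Complex.exp ((Y t ω : ℂ) * (z t : ℝ) * Complex.I) := by
      intro z
      rw [← Complex.exp_sum]
      congr 1
      push_cast
      rw [Finset.sum_mul]
      exact Finset.sum_congr rfl fun t _ => by ring
    simp only [e]
    rw [hγ, integral_fintype_prod_eq_prod fun t (x : ℝ) =>
      Complex.exp ((Y t ω : ℂ) * (x : ℝ) * Complex.I)]
    simp only [← charFun_apply_real, charFun_gaussianReal]
    rw [← Complex.exp_sum, Complex.ofReal_exp]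
    congr 1
    push_cast
    rw [← Finset.sum_neg_distrib, Finset.sum_div]
    exact Finset.sum_congr rfl fun t _ => by ring
  have hmeas : Measurable fun q : Ω × (Fin T → ℝ) =>
      Complex.exp ((∑ t, q.2 t * Y t q.1 : ℝ) * Complex.I) := by fun_prop
  have hswap : ∫ ω, ∫ z, Complex.exp ((∑ t, z t * Y t ω : ℝ) * Complex.I) ∂γ ∂P =
      ∫ z, ∫ ω, Complex.exp ((∑ t, z t * Y t ω : ℝ) * Complex.I) ∂P ∂γ := by
    refine integral_integral_swap (Integrable.of_bound hmeas.aestronglyMeasurable 1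
      (Filter.Eventually.of_forall fun q => ?_))
    exact (Complex.norm_exp_ofReal_mul_I _).le
  simp only [hin] at hswap
  rw [integral_complex_ofReal] at hswap
  have hb : ∀ z : Fin T → ℝ, ‖∫ ω, Complex.exp ((∑ t, z t * Y t ω : ℝ) * Complex.I) ∂P‖ ≤
      ∏ t, Real.exp (-(3 / 2) * z t ^ 2) := by
    intro z
    obtain ⟨s, hs, hle⟩ := hlaw z
    have h1 : ∫ ω, Complex.exp ((∑ t, z t * Y t ω : ℝ) * Complex.I) ∂P =
        charFun (P.map fun ω => ∑ t, z t * Y t ω) 1 := by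
      rw [charFun_apply_real, integral_map (by fun_prop) (by fun_prop)]
      simp
    rw [h1, hs, charFun_gaussianReal, ← Real.exp_sum, Complex.norm_exp, Real.exp_le_exp]
    simp only [← Finset.mul_sum]
    norm_num
    linarith
  have h2 := norm_integral_le_of_norm_le (μ := γ) (Integrable.fintype_prod fun _ =>
    integrable_exp_sq_gaussianReal (b := 3 / 2) (c := 2) two_pos (by norm_num))
    (Filter.Eventually.of_forall hb)
  rw [← hswap, hγ, integral_fintype_prod_eq_prod (fun _ (x : ℝ) => Real.exp (-(3 / 2) * x ^ 2)),
    integral_exp_sq_gaussianReal (b := 3 / 2) (c := 2) two_pos (by norm_num),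
    Complex.norm_real] at h2
  simpa using (le_abs_self _).trans h2

/-- The exponential moment of a Gaussian quadratic form with covariance bounded above. -/
lemma lintegral_exp_sum_sq_le [IsProbabilityMeasure P] (hY : ∀ t, Measurable (Y t))
    (hlaw : ∀ z : Fin T → ℝ, ∃ s : NNReal, P.map (fun ω => ∑ t, z t * Y t ω) = gaussianReal 0 s ∧
      s ≤ 3 / 4 * ∑ t, z t ^ 2) :
    ∫⁻ ω, ENNReal.ofReal (Real.exp ((∑ t, Y t ω ^ 2) / 2)) ∂P ≤ ENNReal.ofReal (2 ^ T) := by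
  set γ : Measure (Fin T → ℝ) := Measure.pi fun _ => gaussianReal 0 1 with hγ
  -- The same linearization with the real moment generating function. Working with `lintegral`
  -- allows the exchange of integrals before finiteness is known.
  have hin : ∀ ω, ∫⁻ z, ENNReal.ofReal (Real.exp (∑ t, z t * Y t ω)) ∂γ =
      ENNReal.ofReal (Real.exp ((∑ t, Y t ω ^ 2) / 2)) := by
    intro ω
    have e : ∀ z : Fin T → ℝ, Real.exp (∑ t, z t * Y t ω) = ∏ t, Real.exp (Y t ω * z t) := by
      intro z
      rw [← Real.exp_sum]
      exact congrArg _ (Finset.sum_congr rfl fun t _ => mul_comm _ _)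
    simp only [e]
    rw [hγ, ← ofReal_integral_eq_lintegral_ofReal
      (Integrable.fintype_prod fun t => integrable_exp_mul_gaussianReal (Y t ω))
      (Filter.Eventually.of_forall fun z => Finset.prod_nonneg fun _ _ => (Real.exp_pos _).le),
      integral_fintype_prod_eq_prod fun t (x : ℝ) => Real.exp (Y t ω * x)]
    have hm : ∀ u : ℝ, ∫ x, Real.exp (u * x) ∂gaussianReal 0 1 = Real.exp (u ^ 2 / 2) := by
      intro u
      have := mgf_gaussianReal (p := gaussianReal 0 1) (X := id) Measure.map_id u
      simpa [mgf] using this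
    simp only [hm]
    rw [← Real.exp_sum, Finset.sum_div]
  simp only [← hin]
  have hmeas : Measurable fun q : Ω × (Fin T → ℝ) =>
      ENNReal.ofReal (Real.exp (∑ t, q.2 t * Y t q.1)) := by fun_prop
  rw [lintegral_lintegral_swap hmeas.aemeasurable]
  have hb : ∀ z : Fin T → ℝ, ∫⁻ ω, ENNReal.ofReal (Real.exp (∑ t, z t * Y t ω)) ∂P ≤
      ENNReal.ofReal (∏ t, Real.exp (-(-(3 / 8)) * z t ^ 2)) := by
    intro z
    obtain ⟨s, hs, hle⟩ := hlaw z
    have h1 : ∫⁻ ω, ENNReal.ofReal (Real.exp (∑ t, z t * Y t ω)) ∂P =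
        ∫⁻ x, ENNReal.ofReal (Real.exp (1 * x)) ∂gaussianReal 0 s := by
      rw [← hs, lintegral_map (by fun_prop) (by fun_prop)]
      simp
    have hm : ∫ x, Real.exp (1 * x) ∂gaussianReal 0 s = Real.exp (s / 2) := by
      have := mgf_gaussianReal (p := gaussianReal 0 s) (X := id) Measure.map_id 1
      simpa [mgf] using this
    rw [h1, ← ofReal_integral_eq_lintegral_ofReal (integrable_exp_mul_gaussianReal 1)
      (Filter.Eventually.of_forall fun _ => (Real.exp_pos _).le), hm, ← Real.exp_sum]
    refine ENNReal.ofReal_le_ofReal (Real.exp_le_exp.2 ?_)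
    simp only [← Finset.mul_sum]
    linarith
  refine (lintegral_mono hb).trans (le_of_eq ?_)
  rw [hγ, ← ofReal_integral_eq_lintegral_ofReal (Integrable.fintype_prod fun _ =>
      integrable_exp_sq_gaussianReal (b := -(3 / 8)) (c := 1 / 2) (by norm_num) (by norm_num))
    (Filter.Eventually.of_forall fun z => Finset.prod_nonneg fun _ _ => (Real.exp_pos _).le),
    integral_fintype_prod_eq_prod (fun _ (x : ℝ) => Real.exp (-(-(3 / 8)) * x ^ 2)),
    integral_exp_sq_gaussianReal (b := -(3 / 8)) (c := 1 / 2) (by norm_num) (by norm_num)]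
  simp

lemma exists_law_scaled {κ₀ κ₁ ρ : ℝ} (hρ : 0 ≤ ρ)
    (hlaw : ∀ z : Fin T → ℝ, ∃ s : NNReal, P.map (fun ω => ∑ t, z t * Y t ω) = gaussianReal 0 s ∧
      κ₀ * ∑ t, z t ^ 2 ≤ s ∧ s ≤ κ₁ * ∑ t, z t ^ 2) (z : Fin T → ℝ) :
    ∃ s : NNReal, P.map (fun ω => ∑ t, z t * (√ρ * Y t ω)) = gaussianReal 0 s ∧
      ρ * κ₀ * ∑ t, z t ^ 2 ≤ s ∧ s ≤ ρ * κ₁ * ∑ t, z t ^ 2 := by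
  obtain ⟨s, h1, h2, h3⟩ := hlaw fun t => √ρ * z t
  have e : ∑ t, (√ρ * z t) ^ 2 = ρ * ∑ t, z t ^ 2 := by
    simp only [mul_pow, Real.sq_sqrt hρ, Finset.mul_sum]
  rw [e] at h2 h3
  refine ⟨s, ?_, by linarith, by linarith⟩
  rw [← h1]
  congr 1
  funext ω
  exact Finset.sum_congr rfl fun t _ => by ring

/-- Lower tail of a Gaussian quadratic form. -/
theorem measureReal_sum_sq_lt_le [IsProbabilityMeasure P] (hY : ∀ t, Measurable (Y t))
    {κ₀ κ₁ : ℝ} (hκ : 0 < κ₀)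
    (hlaw : ∀ z : Fin T → ℝ, ∃ s : NNReal, P.map (fun ω => ∑ t, z t * Y t ω) = gaussianReal 0 s ∧
      κ₀ * ∑ t, z t ^ 2 ≤ s ∧ s ≤ κ₁ * ∑ t, z t ^ 2) :
    P.real {ω | ∑ t, Y t ω ^ 2 < κ₀ / 4 * T} ≤ Real.exp (-(T / 4)) := by
  have hρ : 0 ≤ 3 / κ₀ := by positivity
  have h1 := integral_exp_neg_sum_sq_le (P := P) (Y := fun t ω => √(3 / κ₀) * Y t ω)
    (fun t => (hY t).const_mul _) fun z => by
      obtain ⟨s, h1, h2, -⟩ := exists_law_scaled hρ hlaw z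
      exact ⟨s, h1, by rwa [div_mul_cancel₀ _ hκ.ne'] at h2⟩
  simp only [mul_pow, Real.sq_sqrt hρ, ← Finset.mul_sum] at h1
  have hm : Measurable fun ω => -(3 / κ₀ * ∑ t, Y t ω ^ 2) / 2 := by fun_prop
  have hint : Integrable (fun ω => Real.exp (-(3 / κ₀ * ∑ t, Y t ω ^ 2) / 2)) P := by
    refine Integrable.of_bound (by fun_prop) 1 (Filter.Eventually.of_forall fun ω => ?_)
    rw [Real.norm_eq_abs, Real.abs_exp, Real.exp_le_one_iff]
    have : 0 ≤ 3 / κ₀ * ∑ t, Y t ω ^ 2 :=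
      mul_nonneg hρ (Finset.sum_nonneg fun _ _ => sq_nonneg _)
    linarith
  have h2 := measureReal_le_of_lintegral_exp (P := P) hm (M := (1 / 2) ^ T) (by positivity) (by
    rw [← ofReal_integral_eq_lintegral_ofReal hint
      (Filter.Eventually.of_forall fun _ => (Real.exp_pos _).le)]
    exact ENNReal.ofReal_le_ofReal h1) (-(3 / 8 * T))
  refine (measureReal_mono fun ω hω => ?_).trans (h2.trans ?_)
  · have h3 : ∑ t, Y t ω ^ 2 < κ₀ / 4 * T := hω
    have h4 := mul_le_mul_of_nonneg_left h3.le hρ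
    have h5 : 3 / κ₀ * (κ₀ / 4 * T) = 3 / 4 * T := by field_simp
    change -(3 / 8 * (T : ℝ)) ≤ -(3 / κ₀ * ∑ t, Y t ω ^ 2) / 2
    linarith
  · have h3 : ((1 : ℝ) / 2) ^ T ≤ Real.exp (-(5 / 8) * T) := by
      rw [mul_comm, Real.exp_nat_mul]
      refine pow_le_pow_left₀ (by norm_num) ?_ T
      rw [one_div, ← Real.exp_log two_pos, ← Real.exp_neg, Real.exp_le_exp]
      linarith [Real.log_two_gt_d9]
    calc ((1 : ℝ) / 2) ^ T * Real.exp (-(-(3 / 8 * T)))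
        ≤ Real.exp (-(5 / 8) * T) * Real.exp (-(-(3 / 8 * T))) :=
          mul_le_mul_of_nonneg_right h3 (Real.exp_pos _).le
      _ = Real.exp (-(T / 4)) := by
          rw [← Real.exp_add]
          congr 1
          ring

/-- Upper tail of a Gaussian quadratic form. -/
theorem measureReal_le_sum_sq_le [IsProbabilityMeasure P] (hY : ∀ t, Measurable (Y t))
    {κ₀ κ₁ : ℝ} (hκ : 0 < κ₁)
    (hlaw : ∀ z : Fin T → ℝ, ∃ s : NNReal, P.map (fun ω => ∑ t, z t * Y t ω) = gaussianReal 0 s ∧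
      κ₀ * ∑ t, z t ^ 2 ≤ s ∧ s ≤ κ₁ * ∑ t, z t ^ 2) :
    P.real {ω | 8 * κ₁ * T ≤ ∑ t, Y t ω ^ 2} ≤ Real.exp (-T) := by
  have hρ : 0 ≤ 3 / 4 / κ₁ := by positivity
  have h1 := lintegral_exp_sum_sq_le (P := P) (Y := fun t ω => √(3 / 4 / κ₁) * Y t ω)
    (fun t => (hY t).const_mul _) fun z => by
      obtain ⟨s, h1, -, h2⟩ := exists_law_scaled hρ hlaw z
      exact ⟨s, h1, by rwa [div_mul_cancel₀ _ hκ.ne'] at h2⟩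
  simp only [mul_pow, Real.sq_sqrt hρ, ← Finset.mul_sum] at h1
  have hm : Measurable fun ω => 3 / 4 / κ₁ * (∑ t, Y t ω ^ 2) / 2 := by fun_prop
  have h2 := measureReal_le_of_lintegral_exp (P := P) hm (by positivity) h1 (3 * T)
  refine (measureReal_mono fun ω hω => ?_).trans (h2.trans ?_)
  · have h3 : 8 * κ₁ * T ≤ ∑ t, Y t ω ^ 2 := hω
    have h4 := mul_le_mul_of_nonneg_left h3 hρ
    have h5 : 3 / 4 / κ₁ * (8 * κ₁ * T) = 6 * T := by field_simp; ring
    change 3 * (T : ℝ) ≤ 3 / 4 / κ₁ * (∑ t, Y t ω ^ 2) / 2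
    linarith
  -- The scaled threshold is `6T`, hence `3T` in the exponent; against the moment bound `2 ^ T ≤
  -- exp(2T)` this leaves `exp(-T)`.
  · have h3 : (2 : ℝ) ^ T ≤ Real.exp (2 * T) := by
      rw [mul_comm, Real.exp_nat_mul]
      refine pow_le_pow_left₀ (by norm_num) ?_ T
      linarith [Real.add_one_le_exp (2 : ℝ)]
    calc (2 : ℝ) ^ T * Real.exp (-(3 * T)) ≤ Real.exp (2 * T) * Real.exp (-(3 * T)) :=
          mul_le_mul_of_nonneg_right h3 (Real.exp_pos _).le
      _ = Real.exp (-T) := by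
          rw [← Real.exp_add]
          congr 1
          ring

end Tails

/-! ### The noise term -/

section Martingale

variable {m p : ℕ} {Ω : Type*} [MeasurableSpace Ω] {P : Measure Ω}
  {B : Matrix (Fin m × Fin p) (Fin m × Fin p) ℝ} {σ : ℝ}
  {X ε : ℤ → Ω → (Fin m × Fin p → ℝ)} {lo hi : ℝ}

namespace IsStationaryVAR

lemma variance_noise_apply (h : IsStationaryVAR P B σ X ε) (t : ℤ) (b : Fin m × Fin p) :
    Var[fun ω => ε t ω b; P] = σ ^ 2 := by
  rw [← covariance_self (h.memLp_noise_apply t b).aemeasurable]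
  simpa using h.covariance t b.1 b.2 b.2

variable [IsProbabilityMeasure P]

lemma map_noise_apply (h : IsStationaryVAR P B σ X ε) (t : ℤ) (b : Fin m × Fin p) :
    P.map (fun ω => ε t ω b) = gaussianReal 0 (σ ^ 2).toNNReal := by
  have := h.map_noise t (Pi.single b 1)
  simp only [single_dotProduct, one_mul, h.variance_noise_apply] at this
  exact this

/-- The noise is an independent summand of `X`, so its variance is at most that of a coordinate of
`X`. -/
lemma sq_sigma_le (h : IsStationaryVAR P B σ X ε) (hst : Stable P B X lo hi)
    (hlo : 0 < lo) (b : Fin m × Fin p) : σ ^ 2 ≤ 2 * Real.pi * hi := by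
  have h1 := h.variance_noise hst hlo 0 (Pi.single b 1)
  simp only [single_dotProduct, one_mul, h.variance_noise_apply] at h1
  have h2 : 0 ≤ scalarAutocov P X (Bᵀ *ᵥ Pi.single b 1) 0 := by
    rw [← h.variance_dotProduct hst hlo 0]
    exact variance_nonneg _ _
  have h3 := (hst.toeplitz_bounds hlo b (Pi.single b 1) (κ := Unit) (τ := fun _ => 0)
    (Function.injective_of_subsingleton _) 1).2
  have hsum : ∑ k, (Pi.single b (1 : ℝ) : Fin m × Fin p → ℝ) k ^ 2 = 1 := by
    simp [Pi.single_apply]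
  simp only [hsum, Finset.univ_unique, Pi.one_apply, Finset.sum_const, Finset.card_singleton,
    sub_self, one_smul, mul_one, one_pow, one_mul] at h3
  linarith

/-- The exponential supermartingale of the noise term. -/
lemma lintegral_exp_noise_le (h : IsStationaryVAR P B σ X ε) (a b : Fin m × Fin p) (l : ℝ)
    (n : ℕ) :
    ∫⁻ ω, ENNReal.ofReal (Real.exp (∑ t : Fin n, (l * (X (t : ℕ) ω a * ε ((t : ℕ) + 1) ω b) -
      l ^ 2 * σ ^ 2 / 2 * X (t : ℕ) ω a ^ 2))) ∂P ≤ 1 := by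
  induction n with
  | zero => simp
  | succ n ih =>
    set A : Ω → ℝ := fun ω => ∑ t : Fin n, (l * (X (t : ℕ) ω a * ε ((t : ℕ) + 1) ω b) -
      l ^ 2 * σ ^ 2 / 2 * X (t : ℕ) ω a ^ 2) with hA
    have hX : ∀ t c, Measurable fun ω => X t ω c := h.measurable_apply
    have hε : ∀ t c, Measurable fun ω => ε t ω c := fun t c =>
      (measurable_pi_apply c).comp (h.measurable_noise t)
    have hAm : Measurable A := by
      refine Finset.measurable_sum _ fun t _ => ?_
      have := hX (t : ℕ) a
      have := hε ((t : ℕ) + 1) b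
      fun_prop
    -- Earlier noise is recovered from the path as `X_{t+1} - B X_t`, so the whole exponent up to
    -- step `n` is a function of the past of `X` and independence from the past applies.
    have hind : IndepFun (fun ω => (A ω, X (n : ℕ) ω a)) (fun ω => ε ((n : ℕ) + 1) ω b) P := by
      set F : (Set.Iio ((n : ℤ) + 1) → Fin m × Fin p → ℝ) → ℝ × ℝ := fun y =>
          (∑ t : Fin n, (l * (y ⟨(t : ℕ), by have := t.2; simp only [Set.mem_Iio]; omega⟩ a *
            (y ⟨(t : ℕ) + 1, by have := t.2; simp only [Set.mem_Iio]; omega⟩ b -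
              ∑ c, B b c * y ⟨(t : ℕ), by have := t.2; simp only [Set.mem_Iio]; omega⟩ c)) -
            l ^ 2 * σ ^ 2 / 2 *
              y ⟨(t : ℕ), by have := t.2; simp only [Set.mem_Iio]; omega⟩ a ^ 2),
          y ⟨n, by simp⟩ a) with hF
      have hFm : Measurable F := by fun_prop
      have hFX : ∀ ω, (A ω, X (n : ℕ) ω a) = F fun u => X u ω := by
        intro ω
        simp only [hA, hF, Prod.mk.injEq, and_true]
        refine Finset.sum_congr rfl fun t _ => ?_
        have : ε ((t : ℕ) + 1) ω b = X ((t : ℕ) + 1) ω b - ∑ c, B b c * X (t : ℕ) ω c := by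
          rw [h.recursion]
          simp [Matrix.mulVec, dotProduct]
        rw [this]
      simp only [hFX]
      exact h.indep_functional ((n : ℤ) + 1) (f := fun y => y b) (measurable_pi_apply b) hFm
    have hmap := (indepFun_iff_map_prod_eq_prod_map_map
      (hAm.prodMk (hX (n : ℕ) a)).aemeasurable (hε ((n : ℕ) + 1) b).aemeasurable).1 hind
    rw [h.map_noise_apply] at hmap
    have hinner : ∀ x : ℝ, ∫⁻ e, ENNReal.ofReal (Real.exp (l * (x * e) -
        l ^ 2 * σ ^ 2 / 2 * x ^ 2)) ∂gaussianReal 0 (σ ^ 2).toNNReal = 1 := by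
      intro x
      have e1 : ∀ e, Real.exp (l * (x * e) - l ^ 2 * σ ^ 2 / 2 * x ^ 2) =
          Real.exp (-(l ^ 2 * σ ^ 2 / 2 * x ^ 2)) * Real.exp (l * x * e) := by
        intro e
        rw [← Real.exp_add]
        congr 1
        ring
      have hm := mgf_gaussianReal (p := gaussianReal 0 (σ ^ 2).toNNReal) (X := id)
        Measure.map_id (l * x)
      simp only [mgf, id] at hm
      simp only [e1]
      rw [← ofReal_integral_eq_lintegral_ofReal
        ((integrable_exp_mul_gaussianReal (l * x)).const_mul _)
        (Filter.Eventually.of_forall fun _ => by positivity), integral_const_mul, hm,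
        ← Real.exp_add, Real.coe_toNNReal _ (sq_nonneg σ), ← ENNReal.ofReal_one, ← Real.exp_zero]
      congr 2
      ring
    set F : (ℝ × ℝ) × ℝ → ENNReal := fun q => ENNReal.ofReal (Real.exp q.1.1) *
      ENNReal.ofReal (Real.exp (l * (q.1.2 * q.2) - l ^ 2 * σ ^ 2 / 2 * q.1.2 ^ 2)) with hF
    have hFm : Measurable F := by fun_prop
    have hexp : ∀ ω, ENNReal.ofReal (Real.exp (∑ t : Fin (n + 1),
        (l * (X (t : ℕ) ω a * ε ((t : ℕ) + 1) ω b) - l ^ 2 * σ ^ 2 / 2 * X (t : ℕ) ω a ^ 2))) =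
        F ((A ω, X (n : ℕ) ω a), ε ((n : ℕ) + 1) ω b) := by
      intro ω
      simp only [hA, hF]
      rw [Fin.sum_univ_castSucc, Real.exp_add, ENNReal.ofReal_mul (Real.exp_pos _).le]
      simp
    simp only [hexp]
    rw [← lintegral_map (g := fun ω => ((A ω, X (n : ℕ) ω a), ε ((n : ℕ) + 1) ω b)) hFm
      ((hAm.prodMk (hX (n : ℕ) a)).prodMk (hε ((n : ℕ) + 1) b)), hmap,
      lintegral_prod _ hFm.aemeasurable]
    simp only [hF]
    have e2 : ∀ x : ℝ × ℝ, ∫⁻ y, ENNReal.ofReal (Real.exp x.1) * ENNReal.ofReal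
        (Real.exp (l * (x.2 * y) - l ^ 2 * σ ^ 2 / 2 * x.2 ^ 2))
        ∂gaussianReal 0 (σ ^ 2).toNNReal = ENNReal.ofReal (Real.exp x.1) := by
      intro x
      rw [lintegral_const_mul _ (by fun_prop), hinner, mul_one]
    simp only [e2]
    rw [lintegral_map (by fun_prop) (hAm.prodMk (hX (n : ℕ) a))]
    exact ih

/-- The noise term is small on the event that the sample variance is bounded. -/
theorem measureReal_noise_le (h : IsStationaryVAR P B σ X ε) (a b : Fin m × Fin p) {T : ℕ}
    (hT : 0 < T) {κ L : ℝ} (hκ : 0 < κ) (hσ : σ ^ 2 ≤ κ) (hL : 0 ≤ L) {τ : ℝ}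
    (hτ : τ ^ 2 = 1) :
    P.real {ω | 7 * κ * √(L * T) ≤ τ * ∑ t : Fin T, X (t : ℕ) ω a * ε ((t : ℕ) + 1) ω b ∧
      ∑ t : Fin T, X (t : ℕ) ω a ^ 2 ≤ 8 * κ * T} ≤ Real.exp (-(3 * L)) := by
  have hT' : (0 : ℝ) < T := by exact_mod_cast hT
  -- This `l` maximizes the linear gain minus the quadratic compensator at variance budget `8 κ T`.
  -- The exponent becomes `49/8 L - 49/16 L ≥ 3L`, enough to beat a union over `2 exp(2L)` signed
  -- pairs of coordinates.
  set l : ℝ := 7 * √(L * T) / (8 * κ * T) with hl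
  have hl0 : 0 ≤ l := by positivity
  have hm : Measurable fun ω => ∑ t : Fin T, ((l * τ) * (X (t : ℕ) ω a * ε ((t : ℕ) + 1) ω b) -
      (l * τ) ^ 2 * σ ^ 2 / 2 * X (t : ℕ) ω a ^ 2) := by
    refine Finset.measurable_sum _ fun t _ => ?_
    have := h.measurable_apply (t : ℕ) a
    have := (measurable_pi_apply b).comp (h.measurable_noise ((t : ℕ) + 1))
    simp only [Function.comp_def] at this
    fun_prop
  have h1 := measureReal_le_of_lintegral_exp (P := P) hm zero_le_one
    (by rw [ENNReal.ofReal_one]; exact h.lintegral_exp_noise_le a b (l * τ) T) (3 * L)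
  rw [one_mul] at h1
  refine (measureReal_mono fun ω hω => ?_).trans h1
  obtain ⟨h2, h3⟩ := hω
  change 3 * L ≤ ∑ t : Fin T, ((l * τ) * (X (t : ℕ) ω a * ε ((t : ℕ) + 1) ω b) -
      (l * τ) ^ 2 * σ ^ 2 / 2 * X (t : ℕ) ω a ^ 2)
  rw [Finset.sum_sub_distrib, ← Finset.mul_sum, ← Finset.mul_sum, mul_pow, hτ, mul_one, mul_assoc]
  have h4 := mul_le_mul_of_nonneg_left h2 hl0
  have h5 : l ^ 2 * σ ^ 2 / 2 * ∑ t : Fin T, X (t : ℕ) ω a ^ 2 ≤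
      l ^ 2 * κ / 2 * (8 * κ * T) := by
    refine mul_le_mul ?_ h3 (Finset.sum_nonneg fun _ _ => sq_nonneg _) (by positivity)
    have := mul_le_mul_of_nonneg_left hσ (sq_nonneg l)
    linarith
  have h6 : √(L * T) ^ 2 = L * T := Real.sq_sqrt (by positivity)
  have h7 : l * (7 * κ * √(L * T)) = 49 / 8 * L := by
    rw [hl]
    field_simp
    linear_combination 49 * h6
  have h8 : l ^ 2 * κ / 2 * (8 * κ * T) = 49 / 16 * L := by
    rw [hl]
    field_simp
    linear_combination 784 * h6
  linarith

end IsStationaryVAR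

end Martingale

/-! ### The high probability event -/

section Event

variable {m p : ℕ}

/-- Restricted eigenvalue bound for the sample covariance from its values on finitely many
sparse vectors. -/
theorem sampleCovariance_lower {ι : Type*} [Fintype ι] [DecidableEq ι] {T : ℕ} (hT : 0 < T)
    {x : Fin T → ι → ℝ} {θ K : ℝ} (hθ : 0 ≤ θ) (hK : ∀ b, ∑ t, x t b ^ 2 ≤ K * T) {k : ℕ}
    (hk : 2 ≤ k)
    (hpos : ∀ f : Fin k → ι × Bool,
      θ * (∑ b, signedSum f b ^ 2) * T ≤ ∑ t, (signedSum f ⬝ᵥ x t) ^ 2) (u : ι → ℝ) :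
    θ * ∑ b, u b ^ 2 - K / (k - 1) * (∑ b, |u b|) ^ 2 ≤
      (T : ℝ)⁻¹ * ∑ t, (u ⬝ᵥ x t) ^ 2 := by
  have hT' : (0 : ℝ) < T := by exact_mod_cast hT
  -- Sample covariance minus `θ` times the identity: the hypothesis `hpos` says exactly that its
  -- form is nonnegative on the signed sums.
  set M : Matrix ι ι ℝ := (T : ℝ)⁻¹ • ∑ t, Matrix.vecMulVec (x t) (x t) - θ • 1 with hM
  have hquad : ∀ v : ι → ℝ, v ⬝ᵥ (M *ᵥ v) =
      (T : ℝ)⁻¹ * ∑ t, (v ⬝ᵥ x t) ^ 2 - θ * ∑ b, v b ^ 2 := by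
    intro v
    rw [hM, Matrix.sub_mulVec, dotProduct_sub, Matrix.smul_mulVec, Matrix.smul_mulVec,
      Matrix.one_mulVec, dotProduct_smul, dotProduct_smul, Matrix.sum_mulVec, dotProduct_sum]
    simp only [Matrix.vecMulVec_mulVec, dotProduct_smul, smul_eq_mul, sq]
    congr 2
    refine Finset.sum_congr rfl fun t _ => ?_
    rw [dotProduct_comm (x t) v]
    simp
  have hsymm : M.IsSymm := by
    rw [Matrix.IsSymm, hM, Matrix.transpose_sub, Matrix.transpose_smul, Matrix.transpose_smul,
      Matrix.transpose_one, Matrix.transpose_sum]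
    simp only [Matrix.transpose_vecMulVec]
  have hdiag : ∀ b, M b b ≤ K := by
    intro b
    have h1 : M b b = (T : ℝ)⁻¹ * ∑ t, x t b ^ 2 - θ := by
      simp [hM, Matrix.sum_apply, Matrix.vecMulVec_apply, sq]
    have h2 := mul_le_mul_of_nonneg_left (hK b) (inv_nonneg.2 hT'.le)
    rw [mul_comm K, inv_mul_cancel_left₀ hT'.ne'] at h2
    linarith
  have h1 := quadratic_lower_of_signedSum hsymm hdiag hk (fun f => by
    rw [hquad, sub_nonneg]
    have := mul_le_mul_of_nonneg_left (hpos f) (inv_nonneg.2 hT'.le)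
    rwa [mul_comm _ (T : ℝ), inv_mul_cancel_left₀ hT'.ne'] at this) u
  rw [hquad] at h1
  linarith

variable {Ω : Type*} [MeasurableSpace Ω] {P : Measure Ω} [IsProbabilityMeasure P]
  {B : Matrix (Fin m × Fin p) (Fin m × Fin p) ℝ} {σ : ℝ}
  {X ε : ℤ → Ω → (Fin m × Fin p → ℝ)} {lo hi : ℝ}

/-- The event on which sample variances are bounded, the noise is nearly uncorrelated with the
predictors, and the sample covariance is bounded below on sums of `k` signed basis vectors. -/
def goodEvent (X ε : ℤ → Ω → (Fin m × Fin p → ℝ)) (T k : ℕ) (K δ θ : ℝ) : Set Ω :=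
  {ω | (∀ a, ∑ t : Fin T, X (t : ℕ) ω a ^ 2 ≤ K * T) ∧
    (∀ a b, |∑ t : Fin T, X (t : ℕ) ω a * ε ((t : ℕ) + 1) ω b| ≤ δ) ∧
    ∀ f : Fin k → (Fin m × Fin p) × Bool, θ * (∑ b, signedSum f b ^ 2) * T ≤
      ∑ t : Fin T, (signedSum f ⬝ᵥ X (t : ℕ) ω) ^ 2}

namespace IsStationaryVAR

omit [IsProbabilityMeasure P] in
lemma measurableSet_goodEvent (h : IsStationaryVAR P B σ X ε) (T k : ℕ) (K δ θ : ℝ) :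
    MeasurableSet (goodEvent X ε T k K δ θ) := by
  have hX : ∀ t c, Measurable fun ω => X t ω c := h.measurable_apply
  have hXt : ∀ t, Measurable (X t) := h.measurable_X
  have hε : ∀ t c, Measurable fun ω => ε t ω c := fun t c =>
    (measurable_pi_apply c).comp (h.measurable_noise t)
  have e : goodEvent X ε T k K δ θ = (⋂ a, {ω | ∑ t : Fin T, X (t : ℕ) ω a ^ 2 ≤ K * T}) ∩
      ((⋂ a, ⋂ b, {ω | |∑ t : Fin T, X (t : ℕ) ω a * ε ((t : ℕ) + 1) ω b| ≤ δ}) ∩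
      ⋂ f : Fin k → (Fin m × Fin p) × Bool, {ω | θ * (∑ b, signedSum f b ^ 2) * T ≤
        ∑ t : Fin T, (signedSum f ⬝ᵥ X (t : ℕ) ω) ^ 2}) := by
    ext ω
    simp [goodEvent]
  rw [e]
  exact (MeasurableSet.iInter fun a => measurableSet_le (by fun_prop) (by fun_prop)).inter
    ((MeasurableSet.iInter fun a => MeasurableSet.iInter fun b =>
      measurableSet_le (by fun_prop) (by fun_prop)).inter
    (MeasurableSet.iInter fun f => measurableSet_le (by fun_prop) (by fun_prop)))

/-- A union bound over coordinates, signed pairs and signed words. The noise events may include the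
bound on sample variances, since its failure is already counted in the first family. -/
theorem measureReal_compl_goodEvent_le (h : IsStationaryVAR P B σ X ε)
    (hst : Stable P B X lo hi) (hlo : 0 < lo) (a₀ : Fin m × Fin p) {T : ℕ} (hT : 0 < T) (k : ℕ)
    {κ L : ℝ} (hκ : 0 < κ) (hhi : 2 * Real.pi * hi ≤ κ) (hL : 0 ≤ L) :
    P.real (goodEvent X ε T k (8 * κ) (7 * κ * √(L * T)) (2 * Real.pi * lo / 4))ᶜ ≤
      (m * p : ℕ) * Real.exp (-T) + (m * p : ℕ) ^ 2 * (2 * Real.exp (-(3 * L))) +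
        (2 * (m * p) : ℕ) ^ k * Real.exp (-(T / 4)) := by
  set V : Fin m × Fin p → Set Ω := fun a => {ω | 8 * κ * T ≤ ∑ t : Fin T, X (t : ℕ) ω a ^ 2}
  set W : ℝ → Fin m × Fin p → Fin m × Fin p → Set Ω := fun τ a b =>
    {ω | 7 * κ * √(L * T) ≤ τ * ∑ t : Fin T, X (t : ℕ) ω a * ε ((t : ℕ) + 1) ω b ∧
      ∑ t : Fin T, X (t : ℕ) ω a ^ 2 ≤ 8 * κ * T}
  set R : (Fin k → (Fin m × Fin p) × Bool) → Set Ω := fun f =>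
    {ω | ∑ t : Fin T, (signedSum f ⬝ᵥ X (t : ℕ) ω) ^ 2 <
      2 * Real.pi * lo / 4 * (∑ b, signedSum f b ^ 2) * T}
  have hXm := h.measurable_X
  have hlaw : ∀ (v : Fin m × Fin p → ℝ) (z : Fin T → ℝ), ∃ s : NNReal,
      P.map (fun ω => ∑ t : Fin T, z t * (v ⬝ᵥ X (t : ℕ) ω)) = gaussianReal 0 s ∧
      2 * Real.pi * lo * (∑ b, v b ^ 2) * ∑ t, z t ^ 2 ≤ s ∧
      s ≤ κ * (∑ b, v b ^ 2) * ∑ t, z t ^ 2 := by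
    intro v z
    obtain ⟨s, h1, h2, h3⟩ := h.exists_map_combination hst hlo a₀ v z
    refine ⟨s, h1, h2, h3.trans ?_⟩
    have hv : 0 ≤ ∑ b, v b ^ 2 := Finset.sum_nonneg fun _ _ => sq_nonneg _
    have hz : 0 ≤ ∑ t, z t ^ 2 := Finset.sum_nonneg fun _ _ => sq_nonneg _
    exact mul_le_mul_of_nonneg_right (mul_le_mul_of_nonneg_right hhi hv) hz
  have hV : ∀ a, P.real (V a) ≤ Real.exp (-T) := by
    intro a
    have hsum : ∑ k, (Pi.single a (1 : ℝ) : Fin m × Fin p → ℝ) k ^ 2 = 1 := by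
      simp [Pi.single_apply]
    have := measureReal_le_sum_sq_le (P := P) (Y := fun (t : Fin T) ω => X (t : ℕ) ω a)
      (fun t => h.measurable_apply _ a) (κ₀ := 2 * Real.pi * lo) hκ fun z => by
        simpa [hsum] using hlaw (Pi.single a 1) z
    exact this
  have hσ : σ ^ 2 ≤ κ := (h.sq_sigma_le hst hlo a₀).trans hhi
  have hW : ∀ τ : ℝ, τ ^ 2 = 1 → ∀ a b, P.real (W τ a b) ≤ Real.exp (-(3 * L)) :=
    fun τ hτ a b => h.measureReal_noise_le a b hT hκ hσ hL hτ
  have hR : ∀ f, P.real (R f) ≤ Real.exp (-(T / 4)) := by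
    intro f
    have hn : 0 ≤ ∑ b, signedSum f b ^ 2 := Finset.sum_nonneg fun _ _ => sq_nonneg _
    -- Opposite signs may cancel to the zero vector, for which the Gaussian bound is degenerate and
    -- the event is empty.
    rcases hn.eq_or_lt with h0 | h0
    · have : R f = ∅ := by
        refine Set.eq_empty_of_forall_notMem fun ω hω => ?_
        have h1 : ∑ t : Fin T, (signedSum f ⬝ᵥ X (t : ℕ) ω) ^ 2 <
          2 * Real.pi * lo / 4 * (∑ b, signedSum f b ^ 2) * T := hω
        rw [← h0, mul_zero, zero_mul] at h1
        exact absurd h1 (not_lt.2 (Finset.sum_nonneg fun _ _ => sq_nonneg _))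
      rw [this, measureReal_empty]
      exact (Real.exp_pos _).le
    · have := measureReal_sum_sq_lt_le (P := P)
        (Y := fun (t : Fin T) ω => signedSum f ⬝ᵥ X (t : ℕ) ω) (fun t => by
          have := hXm (t : ℕ)
          fun_prop)
        (κ₀ := 2 * Real.pi * lo * ∑ b, signedSum f b ^ 2) (by positivity) (hlaw (signedSum f))
      refine le_trans (measureReal_mono fun ω hω => ?_) this
      have h1 : ∑ t : Fin T, (signedSum f ⬝ᵥ X (t : ℕ) ω) ^ 2 <
          2 * Real.pi * lo / 4 * (∑ b, signedSum f b ^ 2) * T := hω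
      change ∑ t : Fin T, (signedSum f ⬝ᵥ X (t : ℕ) ω) ^ 2 <
        2 * Real.pi * lo * (∑ b, signedSum f b ^ 2) / 4 * T
      exact h1.trans_eq (by ring)
  have hsub : (goodEvent X ε T k (8 * κ) (7 * κ * √(L * T)) (2 * Real.pi * lo / 4))ᶜ ⊆
      (⋃ a, V a) ∪ (⋃ q : (Fin m × Fin p) × (Fin m × Fin p), W 1 q.1 q.2 ∪ W (-1) q.1 q.2) ∪
        ⋃ f, R f := by
    intro ω hω
    by_contra hn
    simp only [Set.mem_union, Set.mem_iUnion, not_or, not_exists] at hn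
    obtain ⟨⟨h1, h2⟩, h3⟩ := hn
    have hv : ∀ a, ∑ t : Fin T, X (t : ℕ) ω a ^ 2 ≤ 8 * κ * T := fun a => (not_le.1 (h1 a)).le
    refine hω ⟨hv, fun a b => abs_le.2 ⟨?_, ?_⟩, fun f => not_lt.1 (h3 f)⟩
    · by_contra hc
      exact (h2 (a, b)).2 ⟨by linarith [not_le.1 hc], hv a⟩
    · by_contra hc
      exact (h2 (a, b)).1 ⟨by linarith [not_le.1 hc], hv a⟩
  refine (measureReal_mono hsub).trans ((measureReal_union_le _ _).trans (add_le_add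
    ((measureReal_union_le _ _).trans (add_le_add ?_ ?_)) ?_))
  · refine (measureReal_iUnion_fintype_le _).trans ((Finset.sum_le_sum fun a _ => hV a).trans ?_)
    simp
  · refine (measureReal_iUnion_fintype_le _).trans ((Finset.sum_le_sum fun q _ =>
      (measureReal_union_le _ _).trans (add_le_add (hW 1 (by norm_num) _ _)
        (hW (-1) (by norm_num) _ _))).trans (le_of_eq ?_))
    simp
    ring
  · refine (measureReal_iUnion_fintype_le _).trans ((Finset.sum_le_sum fun f _ => hR f).trans
      (le_of_eq ?_))
    simp
    ring

end IsStationaryVAR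

end Event

/-! ### The main theorem -/

section Main

variable {m p : ℕ} {Ω : Type*} [MeasurableSpace Ω] {P : Measure Ω} [IsProbabilityMeasure P]
  {B : Matrix (Fin m × Fin p) (Fin m × Fin p) ℝ} {σ : ℝ}
  {X ε : ℤ → Ω → (Fin m × Fin p → ℝ)} {lo hi : ℝ}

/-- With `mp = exp L`, the four units of `exp(-L)` are one for the variances, two for the noise and
one for the signed words. -/
lemma IsStationaryVAR.goodEvent_probability (h : IsStationaryVAR P B σ X ε)
    (hst : Stable P B X lo hi) (hlo : 0 < lo) (hm : 0 < m) (hp : 0 < p) {T : ℕ} (hT : 0 < T)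
    {κ L : ℝ} (hκ : 0 < κ) (hhi : 2 * Real.pi * hi ≤ κ) (hL : 0 < L)
    (hLmp : L = Real.log m + Real.log p) (hTL : 80 * L ≤ T) :
    1 - 4 * Real.exp (-L) ≤ P.real (goodEvent X ε T ⌊T / (20 * L)⌋₊ (8 * κ) (7 * κ * √(L * T))
      (2 * Real.pi * lo / 4)) := by
  have hm' : (0 : ℝ) < m := by exact_mod_cast hm
  have hp' : (0 : ℝ) < p := by exact_mod_cast hp
  set k := ⌊(T : ℝ) / (20 * L)⌋₊ with hk
  have hexpL : ((m * p : ℕ) : ℝ) = Real.exp L := by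
    rw [hLmp, ← Real.log_mul hm'.ne' hp'.ne', Real.exp_log (by positivity)]
    push_cast
    rfl
  have hmp2 : 2 ≤ m * p := by
    by_contra hlt
    have h1 : m * p = 1 := le_antisymm (by omega) (Nat.mul_pos hm hp)
    rw [h1, Nat.cast_one, eq_comm, Real.exp_eq_one_iff] at hexpL
    exact hL.ne' hexpL
  have hkT : (k : ℝ) * (20 * L) ≤ T := by
    rw [← le_div_iff₀ (by positivity)]
    exact Nat.floor_le (by positivity)
  have h1 := h.measureReal_compl_goodEvent_le hst hlo (⟨0, hm⟩, ⟨0, hp⟩) hT k hκ hhi hL.le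
  have hmeas := h.measurableSet_goodEvent T k (8 * κ) (7 * κ * √(L * T)) (2 * Real.pi * lo / 4)
  rw [probReal_compl_eq_one_sub hmeas] at h1
  have e1 : ((m * p : ℕ) : ℝ) * Real.exp (-T) ≤ Real.exp (-L) := by
    rw [hexpL, ← Real.exp_add, Real.exp_le_exp]
    linarith
  have e2 : ((m * p : ℕ) : ℝ) ^ 2 * (2 * Real.exp (-(3 * L))) = 2 * Real.exp (-L) := by
    rw [hexpL, ← Real.exp_nat_mul, mul_left_comm, ← Real.exp_add]
    congr 2
    push_cast
    ring
  -- As `mp ≥ 2`, the number of words is at most `exp(2Lk) ≤ exp(T/10)`, which is absorbed by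
  -- `exp(-T/4)` because `T ≥ 80L`.
  have e3 : ((2 * (m * p) : ℕ) : ℝ) ^ k * Real.exp (-(T / 4)) ≤ Real.exp (-L) := by
    have h2 : ((2 * (m * p) : ℕ) : ℝ) ≤ Real.exp (2 * L) := by
      have : Real.exp (2 * L) = ((m * p * (m * p) : ℕ) : ℝ) := by
        rw [two_mul, Real.exp_add, ← hexpL]
        push_cast
        ring
      rw [this]
      exact_mod_cast Nat.mul_le_mul_right _ hmp2
    calc ((2 * (m * p) : ℕ) : ℝ) ^ k * Real.exp (-(T / 4))
        ≤ Real.exp (2 * L) ^ k * Real.exp (-(T / 4)) :=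
          mul_le_mul_of_nonneg_right (pow_le_pow_left₀ (Nat.cast_nonneg _) h2 k) (Real.exp_pos _).le
      _ = Real.exp (k * (2 * L) + -(T / 4)) := by rw [← Real.exp_nat_mul, Real.exp_add]
      _ ≤ Real.exp (-L) := by
          rw [Real.exp_le_exp]
          linarith
  linarith

lemma two_le_floor_and_inv_le {L T : ℝ} (hL : 0 < L) (hTL : 80 * L ≤ T) :
    2 ≤ ⌊T / (20 * L)⌋₊ ∧ 1 / ((⌊T / (20 * L)⌋₊ : ℝ) - 1) ≤ 40 * (L / T) := by
  have hT : 0 < T := by linarith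
  have h4 : 4 ≤ T / (20 * L) := by
    rw [le_div_iff₀ (by positivity)]
    linarith
  refine ⟨Nat.le_floor (by push_cast; linarith), ?_⟩
  -- For `y = T / (20L) ≥ 4` the floor minus one exceeds `y - 2`, hence is at least `y / 2`.
  have h1 := Nat.lt_floor_add_one (T / (20 * L))
  have e : 40 * (L / T) = 1 / (T / (20 * L) / 2) := by field_simp; ring
  rw [e]
  exact one_div_le_one_div_of_le (by positivity) (by linarith)

omit [MeasurableSpace Ω] in
/-- On the good event the restricted eigenvalue condition and the deviation bound hold uniformly
over all estimates of the interaction matrix in the given neighbourhood. -/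
theorem TrueParams.conditions_of_goodEvent {J0 : Set (Fin p × Fin p)} {sG sT : ℕ} {g CG : ℝ}
    {G Ghat : Matrix (Fin m) (Fin m) ℝ} {Th : Fin m → Fin m → Matrix (Fin p) (Fin p) ℝ}
    (hpar : TrueParams J0 sG sT g CG G Th) (hg : 0 < g)
    (hrec : ∀ t ω, X t ω = transition G Th *ᵥ X (t - 1) ω + ε t ω) {T : ℕ} (hT : 0 < T)
    {κ L η : ℝ} (hκ : 0 < κ) (hlo : 0 < lo) (hL : 0 < L) (hη : 0 < η)
    (hLmp : L = Real.log m + Real.log p) (hTL : 80 * L ≤ T)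
    (hηg : 4 * η ^ 2 * L ≤ g ^ 2 * T) {ω : Ω}
    (hω : ω ∈ goodEvent X ε T ⌊T / (20 * L)⌋₊ (8 * κ) (7 * κ * √(L * T)) (2 * Real.pi * lo / 4))
    (hclose : ∀ i j, |Ghat i j - G i j| ≤ η * √(Real.log m / T)) :
    RestrictedEigenvalue (gram T (fun t => X t ω) Ghat) (activeCoords G)
        (2 * Real.pi * lo / 4 * (g / 2) ^ 2) (320 * κ * (|CG| + g / 2) ^ 2 * (L / T)) ∧
      DeviationBound T (fun t => X t ω) Ghat (betaTheta Th)
        ((|CG| + η * √(Real.log m / T)) * (7 * κ + η * (sG * sT * (8 * κ)))) := by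
  have hT' : (0 : ℝ) < T := by exact_mod_cast hT
  have hp1 : 0 ≤ Real.log p := Real.log_natCast_nonneg p
  set ν := η * √(Real.log m / T) with hν
  have hν0 : 0 ≤ ν := by positivity
  have hνL : ν ≤ η * √(L / T) := by
    refine mul_le_mul_of_nonneg_left (Real.sqrt_le_sqrt ?_) hη.le
    exact div_le_div_of_nonneg_right (by linarith) hT'.le
  have hLT : η * √(L / T) ≤ g / 2 := by
    refine abs_le_of_sq_le_sq' ?_ (by positivity) |>.2
    rw [mul_pow, Real.sq_sqrt (by positivity), div_pow, ← mul_div_assoc, div_le_div_iff₀ hT'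
      (by norm_num)]
    linarith
  have hνg : ν ≤ g / 2 := hνL.trans hLT
  obtain ⟨hV, hW, hR⟩ := hω
  obtain ⟨hk, hk'⟩ := two_le_floor_and_inv_le hL hTL
  set k := ⌊(T : ℝ) / (20 * L)⌋₊
  constructor
  · have h1 := hpar.restrictedEigenvalue_gram (Ghat := Ghat) (T := T) (x := fun t => X t ω)
      (θ := 2 * Real.pi * lo / 4) (ψ := 320 * κ * (L / T)) hg (by positivity) (by positivity)
      (fun i j => (hclose i j).trans hνg) fun u => by
        refine le_trans (sub_le_sub_left (mul_le_mul_of_nonneg_right ?_ (sq_nonneg _)) _)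
          (sampleCovariance_lower hT (θ := 2 * Real.pi * lo / 4) (by positivity) hV hk hR u)
        have := mul_le_mul_of_nonneg_left hk' (by positivity : 0 ≤ 8 * κ)
        rw [mul_one_div] at this
        linarith
    convert h1 using 1
    ring
  · intro i
    have h1 := hpar.abs_crossMoment_sub_le (Ghat := Ghat) (T := T) (x := fun t => X t ω)
      (ε := fun t => ε t ω) (fun t => hrec t ω) hν0 hclose (K := 8 * κ) (δ := 7 * κ * √(L / T))
      (fun b => by
        have := mul_le_mul_of_nonneg_left (hV b) (inv_nonneg.2 hT'.le)
        rwa [mul_comm (8 * κ), inv_mul_cancel_left₀ hT'.ne'] at this)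
      (fun b b' => by
        have h2 := mul_le_mul_of_nonneg_left (hW b b') (inv_nonneg.2 hT'.le)
        have h3 : √(L * T) = T * √(L / T) := by
          have : L * T = T ^ 2 * (L / T) := by field_simp
          rw [this, Real.sqrt_mul (sq_nonneg _), Real.sqrt_sq hT'.le]
        rw [h3, mul_left_comm _ (T : ℝ), inv_mul_cancel_left₀ hT'.ne'] at h2
        rwa [abs_mul, abs_of_nonneg (inv_nonneg.2 hT'.le)]) i
    -- Of the two occurrences of `ν`, the one multiplying the misspecification is bounded by `η
    -- √(L/T)` to produce the rate; the other remains as the argument of the monotone function.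
    refine h1.trans ?_
    rw [add_comm (Real.log p), ← hLmp, mul_assoc (|CG| + ν)]
    refine mul_le_mul_of_nonneg_left ?_ (by positivity)
    rw [add_mul]
    have := mul_le_mul_of_nonneg_right hνL (by positivity : 0 ≤ (sG : ℝ) * sT * (8 * κ))
    linarith

end Main

end SpatialVAR

end

theorem theorem3 :
    ∃ c₁ c₂ c₃ c₄ : ℝ, 0 < c₁ ∧ 0 < c₂ ∧ 0 < c₃ ∧ 0 < c₄ ∧
    ∀ (r η g CG lo hi : ℝ) (sG sT : ℕ), 1 ≤ r → 0 < η → 0 < g → 0 < lo →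
    ∃ (α φ₀ C : ℝ) (Q : ℝ → ℝ), 0 < α ∧ 0 < φ₀ ∧ 0 < C ∧ Monotone Q ∧
      8 * (1 + r) ^ 2 * sG * sT * (φ₀ / C) ≤ α ∧
    ∀ (m p : ℕ), 0 < m → 0 < p →
    ∀ (J0 : Set (Fin p × Fin p)) (w : Matrix (Fin p) (Fin p) ℝ)
      (G : Matrix (Fin m) (Fin m) ℝ) (Th : Fin m → Fin m → Matrix (Fin p) (Fin p) ℝ),
      SpatialVAR.AdmissibleWeights J0 r w →
      SpatialVAR.TrueParams J0 sG sT g CG G Th →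
    ∀ (σ : ℝ), 0 < σ →
    ∀ (Ω : Type*) [MeasurableSpace Ω] (P : Measure Ω) [IsProbabilityMeasure P]
      (X ε : ℤ → Ω → (Fin m × Fin p → ℝ)),
      SpatialVAR.IsStationaryVAR P (SpatialVAR.transition G Th) σ X ε →
      SpatialVAR.Stable P (SpatialVAR.transition G Th) X lo hi →
    ∀ (T : ℕ), 0 < T →
      -- on the event of the restricted eigenvalue condition and the deviation bound
      (∀ (ω : Ω) (Ghat : Matrix (Fin m) (Fin m) ℝ) (A : Finset (SpatialVAR.Idx m p))
        (a φ q μ : ℝ), SpatialVAR.activeCoords G ⊆ A → 0 < a →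
        8 * (1 + r) ^ 2 * sG * sT * φ ≤ a →
        SpatialVAR.RestrictedEigenvalue (SpatialVAR.gram T (fun t => X t ω) Ghat) A a φ →
        SpatialVAR.DeviationBound T (fun t => X t ω) Ghat (SpatialVAR.betaTheta Th) q →
        0 < μ → 4 * q * √((Real.log m + Real.log p) / T) ≤ μ →
        ∀ β, SpatialVAR.IsThetaUpdate T (fun t => X t ω) Ghat J0 w μ β →
          SpatialVAR.ErrorBound β (SpatialVAR.betaTheta Th) r sG sT a μ) ∧
      -- these events, and hence the error bound, have high probability
      (C * (Real.log m + Real.log p) ≤ T →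
        ∃ E : Set Ω, MeasurableSet E ∧
          1 - c₁ * Real.exp (-c₂ * (Real.log m + Real.log p)) - c₃ * (T : ℝ) ^ (-c₄)
            ≤ P.real E ∧
          ∀ ω ∈ E, ∀ Ghat : Matrix (Fin m) (Fin m) ℝ,
            (∀ i j, |Ghat i j - G i j| ≤ η * √(Real.log m / T)) →
            SpatialVAR.RestrictedEigenvalue (SpatialVAR.gram T (fun t => X t ω) Ghat)
              (SpatialVAR.activeCoords G) α (φ₀ * ((Real.log m + Real.log p) / T)) ∧
            SpatialVAR.DeviationBound T (fun t => X t ω) Ghat (SpatialVAR.betaTheta Th)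
              (Q (η * √(Real.log m / T))) ∧
            ∀ μ : ℝ, 0 < μ →
              4 * Q (η * √(Real.log m / T)) * √((Real.log m + Real.log p) / T) ≤ μ →
              (∃ β, SpatialVAR.IsThetaUpdate T (fun t => X t ω) Ghat J0 w μ β) ∧
              ∀ β, SpatialVAR.IsThetaUpdate T (fun t => X t ω) Ghat J0 w μ β →
                SpatialVAR.ErrorBound β (SpatialVAR.betaTheta Th) r sG sT α μ) := by
  -- The constants 4 and 1 come from the failure probability `4 exp(-L)`; the polynomial term in `T`
  -- is slack.
  refine ⟨4, 1, 1, 1, by norm_num, one_pos, one_pos, one_pos, ?_⟩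
  intro r η g CG lo hi sG sT hr hη hg hlo
  -- The absolute value and the added one keep `κ` positive, since `hi` is quantified without a sign
  -- condition.
  set κ : ℝ := 2 * Real.pi * (|hi| + 1) with hκdef
  have hκ : 0 < κ := by positivity
  have hhi : 2 * Real.pi * hi ≤ κ :=
    mul_le_mul_of_nonneg_left (by linarith [le_abs_self hi]) Real.two_pi_pos.le
  set α : ℝ := 2 * Real.pi * lo / 4 * (g / 2) ^ 2 with hα
  set φ₀ : ℝ := 320 * κ * (|CG| + g / 2) ^ 2 with hφ₀
  have hα0 : 0 < α := by positivity
  have hφ0 : 0 < φ₀ := by positivity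
  have hr0 : 0 < r := by linarith
  set D : ℝ := 8 * (1 + r) ^ 2 * sG * sT * φ₀ / α with hD
  have hD0 : 0 ≤ D := by positivity
  -- One summand per demand: enough samples for the Maurey words, `ν ≤ g / 2`, and the compatibility
  -- of tolerance and curvature.
  set C : ℝ := 80 + 4 * η ^ 2 / g ^ 2 + D with hC
  have hC1 : 80 ≤ C := by
    have : 0 ≤ 4 * η ^ 2 / g ^ 2 := by positivity
    linarith
  have hC2 : 4 * η ^ 2 / g ^ 2 ≤ C := by linarith
  have hC3 : D ≤ C := by
    have : 0 ≤ 4 * η ^ 2 / g ^ 2 := by positivity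
    linarith
  have hC0 : 0 < C := by linarith
  have hcond : 8 * (1 + r) ^ 2 * sG * sT * (φ₀ / C) ≤ α := by
    rw [← mul_div_assoc, div_le_iff₀ hC0, ← div_le_iff₀' hα0]
    exact hC3
  refine ⟨α, φ₀, C, fun ν => (|CG| + max ν 0) * (7 * κ + η * (sG * sT * (8 * κ))), hα0, hφ0, hC0,
    fun ν ν' hν => mul_le_mul_of_nonneg_right (add_le_add_right (max_le_max_right 0 hν) _)
      (by positivity), hcond, ?_⟩
  intro m p hm hp J0 w G Th hw hpar σ hσ Ω _ P _ X ε hX hst T hT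
  refine ⟨fun ω Ghat A a φ q μ hA ha hφ hRE hdev hμ hqμ β hβ =>
    hpar.errorBound hr hw hA ha hφ hRE hdev hμ hqμ hβ, fun hTC => ?_⟩
  have hT' : (0 : ℝ) < T := by exact_mod_cast hT
  set L : ℝ := Real.log m + Real.log p with hLdef
  have hL0 : 0 ≤ L := add_nonneg (Real.log_natCast_nonneg m) (Real.log_natCast_nonneg p)
  have hTpow : 0 ≤ 1 * (T : ℝ) ^ (-1 : ℝ) := by positivity
  -- If `m = p = 1` then `L = 0`, the required probability is negative, and the empty event will do.
  rcases hL0.eq_or_lt with hL | hL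
  · refine ⟨∅, MeasurableSet.empty, ?_, fun ω hω => absurd hω (Set.notMem_empty ω)⟩
    rw [← hL, mul_zero, Real.exp_zero, measureReal_empty]
    linarith
  have hTL : 80 * L ≤ T := (mul_le_mul_of_nonneg_right hC1 hL0).trans hTC
  have hηg : 4 * η ^ 2 * L ≤ g ^ 2 * T := by
    have h1 := (mul_le_mul_of_nonneg_right hC2 hL0).trans hTC
    rw [div_mul_eq_mul_div, div_le_iff₀ (by positivity)] at h1
    linarith
  refine ⟨_, hX.measurableSet_goodEvent T ⌊T / (20 * L)⌋₊ (8 * κ) (7 * κ * √(L * T))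
    (2 * Real.pi * lo / 4), ?_, fun ω hω Ghat hclose => ?_⟩
  · have := hX.goodEvent_probability hst hlo hm hp hT hκ hhi hL hLdef hTL
    rw [neg_one_mul]
    linarith
  · obtain ⟨h1, h2⟩ := hpar.conditions_of_goodEvent hg hX.recursion hT hκ hlo hL hη hLdef hTL
      hηg hω hclose
    have hmax : max (η * √(Real.log m / T)) 0 = η * √(Real.log m / T) :=
      max_eq_left (by positivity)
    simp only [hmax]
    refine ⟨h1, h2, fun μ hμ hqμ => ⟨SpatialVAR.exists_thetaUpdate hw hμ, fun β hβ => ?_⟩⟩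
    -- The tolerance `φ₀ L / T` is at most `φ₀ / C` because `C L ≤ T`, so `hcond` gives the side
    -- condition.
    refine hpar.errorBound hr hw Finset.Subset.rfl hα0 (le_trans ?_ hcond) h1 h2 hμ hqμ hβ
    refine mul_le_mul_of_nonneg_left ?_ (by positivity)
    rw [div_eq_mul_inv φ₀]
    refine mul_le_mul_of_nonneg_left ?_ hφ0.le
    rw [div_le_iff₀ hT', inv_mul_eq_div, le_div_iff₀ hC0]
    linarith
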